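/- Let $R=[r^1,\dots,r^k]\in\mathbb{Q}^{2\times k}$ have nonzero columns and let $f\in\mathbb{Q}^2\setminus\mathbb{Z}^2$. Put $$P(R,f)^0=\{(x,s)\in\mathbb{R}^2\times\mathbb{R}^k_+ : f+Rs=x\},\qquad P(R,f)=\{(x,s)\in P(R,f)^0 : x\in\mathbb{Z}^2\},$$ and assume $P(R,f)\neq\emptyset$. Let $\sum_{i=1}^k\alpha_i s_i\ge 1$, with $\alpha_i\ge 0$ for all $i$, be a valid inequality for $\mathrm{conv}(P(R,f))$, and let $$L_\alpha=\mathrm{conv}\Big(\{f\}\cup\big\{f+\tfrac{r^i}{\alpha_i} : \alpha_i>0\big\}\Big)+\mathrm{cone}\{r^i : \alpha_i=0\}$$ be its induced lattice-free set. Suppose that $L_\alpha$ is a triangle of type $T^3$, that is, a triangle with no integer point in its interior, with non-integral vertices, and with exactly three integer points on its boundary, one in the relative interior of each side. Then the inequality $\sum_{i=1}^k\alpha_i s_i\ge 1$ has finite split rank with respect to $P(R,f)^0$. Here, for $S\subseteq\mathbb{R}^2\times\mathbb{R}^k$, the split closure of $S$ is $$\bigcap_{\pi\in\mathbb{Z}^2,\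 \pi_0\in\mathbb{Z}}\mathrm{conv}\big((S\cap\{(x,s):\pi^Tx\le\pi_0\})\cup(S\cap\{(x,s):\pi^Tx\ge\pi_0+1\})\big),$$ the $0$-th split closure of $P(R,f)^0$ is $P(R,f)^0$ itself and the $(n+1)$-st is the split closure of the $n$-th; the split rank of an inequality is the least $n\ge 0$ such that it is valid for the $n$-th split closure, and is infinite if there is no such $n$. -/

import Mathlib

namespace SplitRank

/-- The integer points of `ℝ^p`. -/
def latticePoints (p : ℕ) : Set (Fin p → ℝ) :=
  Set.range fun z : Fin p → ℤ => fun j => (z j : ℝ)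

/-- The part `(S ∩ {πᵀx ≤ π₀}) ∪ (S ∩ {πᵀx ≥ π₀ + 1})` of a set `S ⊆ ℝ^p × ℝ^q` satisfying the
split disjunction given by `π ∈ ℤ^p` and `π₀ ∈ ℤ`, followed by taking the convex hull. -/
def splitHull {p q : ℕ} (S : Set ((Fin p → ℝ) × (Fin q → ℝ))) (π : Fin p → ℤ) (π₀ : ℤ) :
    Set ((Fin p → ℝ) × (Fin q → ℝ)) :=
  convexHull ℝ
    ((S ∩ {z | ∑ j, (π j : ℝ) * z.1 j ≤ (π₀ : ℝ)}) ∪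
      (S ∩ {z | (π₀ : ℝ) + 1 ≤ ∑ j, (π j : ℝ) * z.1 j}))

/-- One round of the split closure: the intersection over all split disjunctions. -/
def splitClosure {p q : ℕ} (S : Set ((Fin p → ℝ) × (Fin q → ℝ))) :
    Set ((Fin p → ℝ) × (Fin q → ℝ)) :=
  ⋂ (π : Fin p → ℤ) (π₀ : ℤ), splitHull S π π₀

/-- The `n`-th split closure; the `0`-th one is the linear relaxation `S` itself. -/
def iterSplitClosure {p q : ℕ} (S : Set ((Fin p → ℝ) × (Fin q → ℝ))) :
    ℕ → Set ((Fin p → ℝ) × (Fin q → ℝ))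
  | 0 => S
  | n + 1 => splitClosure (iterSplitClosure S n)

/-- The inequality `aᵀx + bᵀy ≤ c` holds on all of `S`. -/
def IsValidIneq {p q : ℕ} (a : Fin p → ℝ) (b : Fin q → ℝ) (c : ℝ)
    (S : Set ((Fin p → ℝ) × (Fin q → ℝ))) : Prop :=
  ∀ z ∈ S, ∑ j, a j * z.1 j + ∑ i, b i * z.2 i ≤ c

/-- The split rank of `aᵀx + bᵀy ≤ c` with respect to the linear relaxation `S`: the least `n`
such that the inequality is valid for the `n`-th split closure, and `⊤` if there is none. -/
noncomputable def splitRank {p q : ℕ} (S : Set ((Fin p → ℝ) × (Fin q → ℝ)))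
    (a : Fin p → ℝ) (b : Fin q → ℝ) (c : ℝ) : ℕ∞ :=
  sInf {m : ℕ∞ | ∃ n : ℕ, m = (n : ℕ∞) ∧ IsValidIneq a b c (iterSplitClosure S n)}

/-- The `i`-th column of `R`, as a vector of `ℝ²`. -/
def col {k : ℕ} (R : Matrix (Fin 2) (Fin k) ℚ) (i : Fin k) : Fin 2 → ℝ :=
  fun j => (R j i : ℝ)

/-- A rational point of the plane, as a vector of `ℝ²`. -/
def toReal (f : Fin 2 → ℚ) : Fin 2 → ℝ :=
  fun j => (f j : ℝ)

/-- The linear relaxation `P(R,f)⁰ = {(x,s) ∈ ℝ² × ℝ^k | f + R s = x, s ≥ 0}`. -/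
def relaxation {k : ℕ} (R : Matrix (Fin 2) (Fin k) ℚ) (f : Fin 2 → ℚ) :
    Set ((Fin 2 → ℝ) × (Fin k → ℝ)) :=
  {z | toReal f + ∑ i, z.2 i • col R i = z.1 ∧ ∀ i, 0 ≤ z.2 i}

/-- The mixed integer set `P(R,f) = {(x,s) ∈ ℤ² × ℝ^k | f + R s = x, s ≥ 0}`. -/
def mixedIntegerSet {k : ℕ} (R : Matrix (Fin 2) (Fin k) ℚ) (f : Fin 2 → ℚ) :
    Set ((Fin 2 → ℝ) × (Fin k → ℝ)) :=
  {z ∈ relaxation R f | z.1 ∈ latticePoints 2}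

open scoped Pointwise in
/-- The set
`L_α = conv ({f} ∪ {f + rⁱ/αᵢ | αᵢ > 0}) + cone {rⁱ | αᵢ = 0}` induced by `∑ αᵢ sᵢ ≥ 1`. -/
def inducedSet {k : ℕ} (R : Matrix (Fin 2) (Fin k) ℚ) (f : Fin 2 → ℚ) (α : Fin k → ℝ) :
    Set (Fin 2 → ℝ) :=
  convexHull ℝ (insert (toReal f) {y | ∃ i, 0 < α i ∧ y = toReal f + (α i)⁻¹ • col R i}) +
    {y | ∃ c : Fin k → ℝ, (∀ i, 0 ≤ c i) ∧ (∀ i, α i ≠ 0 → c i = 0) ∧ y = ∑ i, c i • col R i}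

/-- No integer point lies in the interior. -/
def IsLatticeFree (T : Set (Fin 2 → ℝ)) : Prop :=
  interior T ∩ latticePoints 2 = ∅

/-- `T` is a triangle of type `T³`: a (nondegenerate) lattice-free triangle with non-integral
vertices and exactly three integer points on its boundary, one in the relative interior of each
side. -/
def IsTypeT3 (T : Set (Fin 2 → ℝ)) : Prop :=
  ∃ w : Fin 3 → (Fin 2 → ℝ),
    AffineIndependent ℝ w ∧
    T = convexHull ℝ (Set.range w) ∧
    IsLatticeFree T ∧
    (∀ i, w i ∉ latticePoints 2) ∧
    (frontier T ∩ latticePoints 2).ncard = 3 ∧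
    ∀ i j, i ≠ j → ∃! y, y ∈ openSegment ℝ (w i) (w j) ∧ y ∈ latticePoints 2

end SplitRank

/-! Write ζ(s) = ∑ αⱼ sⱼ, and let ℓᵢ be the slack of the i-th side of `L_α`, scaled so that ℓᵢ(f) =
1. Every point of the relaxation satisfies ζ ≥ 1 - ℓᵢ(x), so only points over the interior of the
triangle can violate the inequality. The three boundary integer points yᵢ span a unimodular triangle
(`area_sq_eq_one`), so their barycentric coordinates λᵢ are integral affine forms and define splits
0 ≤ λᵢ ≤ 1. Up to orientation, ℓᵢ(yᵢ₊₁) > ℓᵢ(yᵢ₊₂) for every i (`slack_cyclic`), and this makes the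
three splits cover the interior.

A point of the next closure lying inside a split is a convex combination of points of the previous
closure on the two lines of the split. The strictly convex function ∑ λᵢ² drops under this
averaging, by a uniform amount away from the sides, so small values of ζ cannot persist and the
lower bound on ζ tends to at least 1 (`exists_lower_bound`).

Exactness after finitely many rounds needs more. Splits parallel to the rational sides turn a bound
1 - ε into 1 - δ ℓᵢ with δ arbitrarily small (`exists_slope_bound`). On a line λᵢ = 0, a point is a
combination of two points, one of which lies on or beyond a side, where ζ exceeds 1 linearly; for
small δ this gain pays for the loss at the other (`exists_one_le_of_bary_eq_zero`). By convexity a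
point with ζ < 1 then fixes which λᵢ are positive at all such points, and going round the three
splits contradicts this (`exists_one_le`).

The application requires f to be interior, which follows from validity (`coord_pos_of_isValidIneq`),
and the sides to be rational although α is only real (`vertex_rational`). -/

namespace SplitRank

/-! ### Split hulls and iterated split closures of convex sets. -/

variable {p q : ℕ}

/-- The affine form `x ↦ πᵀx - π₀` with integer coefficients. -/
def latForm (π : Fin p → ℤ) (π₀ : ℤ) (x : Fin p → ℝ) : ℝ :=
  ∑ j, (π j : ℝ) * x j - π₀

lemma latForm_comb (π : Fin p → ℤ) (π₀ : ℤ) (x y : Fin p → ℝ) {a b : ℝ} (hab : a + b = 1) :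
    latForm π π₀ (a • x + b • y) = a * latForm π π₀ x + b * latForm π π₀ y := by
  have h : ∑ j, (π j : ℝ) * (a • x + b • y) j
      = a * ∑ j, (π j : ℝ) * x j + b * ∑ j, (π j : ℝ) * y j := by
    rw [Finset.mul_sum, Finset.mul_sum, ← Finset.sum_add_distrib]
    refine Finset.sum_congr rfl fun j _ => ?_
    simp only [Pi.add_apply, Pi.smul_apply, smul_eq_mul]; ring
  unfold latForm
  rw [h]
  linear_combination (π₀ : ℝ) * hab

lemma continuous_latForm (π : Fin p → ℤ) (π₀ : ℤ) : Continuous (latForm π π₀) := by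
  unfold latForm; fun_prop

/-- A point of the split hull strictly between the two hyperplanes of the split is a convex
combination of points of the set on the two hyperplanes. -/
lemma exists_comb_of_mem_splitHull {S : Set ((Fin p → ℝ) × (Fin q → ℝ))} (hS : Convex ℝ S)
    {π : Fin p → ℤ} {π₀ : ℤ} {z : (Fin p → ℝ) × (Fin q → ℝ)} (hz : z ∈ splitHull S π π₀)
    (h0 : 0 < latForm π π₀ z.1) (h1 : latForm π π₀ z.1 < 1) :
    ∃ u ∈ S, ∃ v ∈ S, latForm π π₀ u.1 = 0 ∧ latForm π π₀ v.1 = 1 ∧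
      z = (1 - latForm π π₀ z.1) • u + latForm π π₀ z.1 • v := by
  set A := S ∩ {z : (Fin p → ℝ) × (Fin q → ℝ) | ∑ j, (π j : ℝ) * z.1 j ≤ (π₀ : ℝ)} with hA
  set B := S ∩ {z : (Fin p → ℝ) × (Fin q → ℝ) | (π₀ : ℝ) + 1 ≤ ∑ j, (π j : ℝ) * z.1 j} with hB
  have hA' : ∀ w, w ∈ A ↔ w ∈ S ∧ latForm π π₀ w.1 ≤ 0 := fun w => by
    simp only [hA, Set.mem_inter_iff, Set.mem_ofPred_eq, latForm, sub_nonpos]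
  have hB' : ∀ w, w ∈ B ↔ w ∈ S ∧ 1 ≤ latForm π π₀ w.1 := fun w => by
    simp only [hB, Set.mem_inter_iff, Set.mem_ofPred_eq, latForm, le_sub_iff_add_le, add_comm]
  have comb : ∀ (u v : (Fin p → ℝ) × (Fin q → ℝ)) (a b : ℝ), a + b = 1 →
      latForm π π₀ (a • u + b • v).1 = a * latForm π π₀ u.1 + b * latForm π π₀ v.1 :=
    fun u v a b hab => latForm_comb π π₀ u.1 v.1 hab
  have cA : Convex ℝ A := by
    intro u hu v hv a b ha hb hab
    rw [hA'] at *
    refine ⟨hS hu.1 hv.1 ha hb hab, ?_⟩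
    rw [comb u v a b hab]; nlinarith [hu.2, hv.2]
  have cB : Convex ℝ B := by
    intro u hu v hv a b ha hb hab
    rw [hB'] at *
    refine ⟨hS hu.1 hv.1 ha hb hab, ?_⟩
    rw [comb u v a b hab]; nlinarith [hu.2, hv.2]
  change z ∈ convexHull ℝ (A ∪ B) at hz
  rcases A.eq_empty_or_nonempty with hAe | hAn
  · rw [hAe, Set.empty_union, cB.convexHull_eq, hB'] at hz
    linarith [hz.2]
  rcases B.eq_empty_or_nonempty with hBe | hBn
  · rw [hBe, Set.union_empty, cA.convexHull_eq, hA'] at hz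
    linarith [hz.2]
  rw [convexHull_union hAn hBn, cA.convexHull_eq, cB.convexHull_eq, mem_convexJoin] at hz
  obtain ⟨u, hu, v, hv, a, b, ha, hb, hab, rfl⟩ := hz
  rw [hA'] at hu
  rw [hB'] at hv
  rw [comb u v a b hab] at h0 h1 ⊢
  set s := latForm π π₀ u.1
  set t := latForm π π₀ v.1
  have hN : 0 < t - s := by linarith [hu.2, hv.2]
  have e1 : t / (t - s) + -s / (t - s) = 1 := by field_simp; ring
  have e2 : (t - 1) / (t - s) + (1 - s) / (t - s) = 1 := by field_simp; ring
  -- The segment from `u` to `v` crosses the two hyperplanes at these points; `s ≤ 0` and `t ≥ 1`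
  -- make the weights nonnegative.
  refine ⟨(t / (t - s)) • u + (-s / (t - s)) • v, hS hu.1 hv.1 ?_ ?_ e1,
    ((t - 1) / (t - s)) • u + ((1 - s) / (t - s)) • v, hS hu.1 hv.1 ?_ ?_ e2, ?_, ?_, ?_⟩
  · exact div_nonneg (by linarith [hv.2]) hN.le
  · exact div_nonneg (by linarith [hu.2]) hN.le
  · exact div_nonneg (by linarith [hv.2]) hN.le
  · exact div_nonneg (by linarith [hu.2]) hN.le
  · rw [comb _ _ _ _ e1]; field_simp; ring
  · rw [comb _ _ _ _ e2]; field_simp; ring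
  · obtain rfl : a = 1 - b := by linarith
    simp only [smul_add, smul_smul]
    rw [add_add_add_comm, ← add_smul, ← add_smul]
    congr 2 <;> (field_simp; ring)

lemma splitHull_subset {S : Set ((Fin p → ℝ) × (Fin q → ℝ))} (hS : Convex ℝ S)
    (π : Fin p → ℤ) (π₀ : ℤ) : splitHull S π π₀ ⊆ S :=
  convexHull_min (Set.union_subset Set.inter_subset_left Set.inter_subset_left) hS

lemma splitClosure_subset {S : Set ((Fin p → ℝ) × (Fin q → ℝ))} (hS : Convex ℝ S) :
    splitClosure S ⊆ S := fun _ hz =>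
  splitHull_subset hS 0 0 (Set.mem_iInter₂.1 hz 0 0)

lemma convex_iterSplitClosure {S : Set ((Fin p → ℝ) × (Fin q → ℝ))} (hS : Convex ℝ S) (n : ℕ) :
    Convex ℝ (iterSplitClosure S n) := by
  cases n with
  | zero => exact hS
  | succ n => exact convex_iInter₂ fun _ _ => convex_convexHull ℝ _

lemma iterSplitClosure_antitone {S : Set ((Fin p → ℝ) × (Fin q → ℝ))} (hS : Convex ℝ S) :
    Antitone (iterSplitClosure S) :=
  antitone_nat_of_succ_le fun n => splitClosure_subset (convex_iterSplitClosure hS n)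

/-- The decomposition of a point of the next split closure along a split containing it. -/
lemma exists_comb_of_mem_succ {S : Set ((Fin p → ℝ) × (Fin q → ℝ))} (hS : Convex ℝ S) {n : ℕ}
    {z : (Fin p → ℝ) × (Fin q → ℝ)} (hz : z ∈ iterSplitClosure S (n + 1))
    (π : Fin p → ℤ) (π₀ : ℤ)
    (h0 : 0 < latForm π π₀ z.1) (h1 : latForm π π₀ z.1 < 1) :
    ∃ u ∈ iterSplitClosure S n, ∃ v ∈ iterSplitClosure S n,
      latForm π π₀ u.1 = 0 ∧ latForm π π₀ v.1 = 1 ∧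
      z = (1 - latForm π π₀ z.1) • u + latForm π π₀ z.1 • v :=
  exists_comb_of_mem_splitHull (convex_iterSplitClosure hS n)
    (Set.mem_iInter₂.1 hz π π₀) h0 h1

end SplitRank

/-! ### Cyclic triangles: the three covering splits and the potential. -/

namespace SplitRank

/-- A triangle `{x | ∀ i, 0 ≤ ℓᵢ x}` with slack functions `ℓᵢ = Aᵢ λᵢ₊₁ + Bᵢ λᵢ₊₂`, where the `λᵢ`
are integral affine forms that are barycentric coordinates with respect to three integer points on
the sides, and `Aᵢ > Bᵢ > 0`. Each `ℓᵢ` is a positive multiple of an integral affine form. -/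
structure CyclicTriangle (p : ℕ) where
  π : Fin 3 → Fin p → ℤ
  π₀ : Fin 3 → ℤ
  A : Fin 3 → ℝ
  B : Fin 3 → ℝ
  ρ : Fin 3 → Fin p → ℤ
  ρ₀ : Fin 3 → ℤ
  κ : Fin 3 → ℝ
  sum_eq_one : ∀ x, ∑ i, latForm (π i) (π₀ i) x = 1
  B_pos : ∀ i, 0 < B i
  B_lt_A : ∀ i, B i < A i
  κ_pos : ∀ i, 0 < κ i
  slack_eq : ∀ i x, A i * latForm (π (i + 1)) (π₀ (i + 1)) x
    + B i * latForm (π (i + 2)) (π₀ (i + 2)) x = κ i * latForm (ρ i) (ρ₀ i) x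
  isCompact : IsCompact {x | ∀ i, 0 ≤ latForm (ρ i) (ρ₀ i) x}

namespace CyclicTriangle

variable {p q : ℕ} (T : CyclicTriangle p)

/-- The barycentric coordinate `λᵢ`. -/
def bary (i : Fin 3) (x : Fin p → ℝ) : ℝ := latForm (T.π i) (T.π₀ i) x

/-- The slack `ℓᵢ` of the `i`-th side. -/
def slack (i : Fin 3) (x : Fin p → ℝ) : ℝ := T.κ i * latForm (T.ρ i) (T.ρ₀ i) x

lemma slack_eq_bary (i : Fin 3) (x : Fin p → ℝ) :
    T.slack i x = T.A i * T.bary (i + 1) x + T.B i * T.bary (i + 2) x :=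
  (T.slack_eq i x).symm

lemma bary_comb (i : Fin 3) (x y : Fin p → ℝ) {a b : ℝ} (hab : a + b = 1) :
    T.bary i (a • x + b • y) = a * T.bary i x + b * T.bary i y :=
  latForm_comb _ _ x y hab

lemma bary_add (i : Fin 3) (x : Fin p → ℝ) :
    T.bary i x + T.bary (i + 1) x + T.bary (i + 2) x = 1 := by
  have h := T.sum_eq_one x
  rw [Fin.sum_univ_three] at h
  fin_cases i
  · exact h
  · change T.bary 1 x + T.bary 2 x + T.bary 0 x = 1
    change T.bary 0 x + T.bary 1 x + T.bary 2 x = 1 at h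
    linarith
  · change T.bary 2 x + T.bary 0 x + T.bary 1 x = 1
    change T.bary 0 x + T.bary 1 x + T.bary 2 x = 1 at h
    linarith

lemma continuous_bary (i : Fin 3) : Continuous (T.bary i) := continuous_latForm _ _

lemma continuous_slack (i : Fin 3) : Continuous (T.slack i) :=
  continuous_const.mul (continuous_latForm _ _)

lemma slack_add_one (i : Fin 3) (x : Fin p → ℝ) :
    T.slack (i + 1) x = T.A (i + 1) * T.bary (i + 2) x + T.B (i + 1) * T.bary i x := by
  rw [slack_eq_bary, add_assoc, add_assoc]
  rw [show i + (1 + 1) = i + 2 from rfl, show i + (1 + 2) = i from by fin_cases i <;> rfl]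

lemma slack_add_two (i : Fin 3) (x : Fin p → ℝ) :
    T.slack (i + 2) x = T.A (i + 2) * T.bary i x + T.B (i + 2) * T.bary (i + 1) x := by
  rw [slack_eq_bary, add_assoc, add_assoc]
  rw [show i + (2 + 1) = i from by fin_cases i <;> rfl,
    show i + (2 + 2) = i + 1 from by fin_cases i <;> rfl]

/-- Otherwise λᵢ₊₂ ≤ -λᵢ, hence ℓᵢ₊₁ = Aᵢ₊₁ λᵢ₊₂ + Bᵢ₊₁ λᵢ ≤ -(Aᵢ₊₁ - Bᵢ₊₁) λᵢ ≤ 0. The cyclic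
orientation enters here through Bᵢ₊₁ < Aᵢ₊₁. -/
lemma bary_lt_one {x : Fin p → ℝ} (hx : ∀ i, 0 < T.slack i x) {i : Fin 3}
    (h0 : 0 ≤ T.bary i x) : T.bary (i + 1) x < 1 := by
  by_contra! h
  have h1 := hx (i + 1)
  rw [slack_add_one] at h1
  have h2 := T.bary_add i x
  have h3 := T.B_pos (i + 1)
  have h4 := T.B_lt_A (i + 1)
  nlinarith [mul_nonneg (sub_nonneg.2 h4.le) h0]

/-- Every interior point of the triangle is in the interior of one of the three splits. -/
lemma exists_bary_mem_Ioo {x : Fin p → ℝ} (hx : ∀ i, 0 < T.slack i x) :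
    ∃ i, 0 < T.bary i x ∧ T.bary i x < 1 := by
  by_contra! h
  -- A positive λᵢ would be at least 1, forcing the other two to be nonpositive by `bary_lt_one`,
  -- and then ℓᵢ ≤ 0.
  have key : ∀ i, T.bary i x ≤ 0 := by
    intro i
    by_contra! hi
    have h1 := h i hi
    have h2 : T.bary (i + 1) x ≤ 0 := by
      by_contra! h3
      exact absurd (h _ h3) (not_le.2 (T.bary_lt_one hx hi.le))
    have h3 : T.bary (i + 2) x ≤ 0 := by
      by_contra! h3
      have h4 := T.bary_lt_one hx h3.le
      rw [add_assoc, show i + (2 + 1) = i from by fin_cases i <;> rfl] at h4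
      linarith
    have h5 := hx i
    rw [slack_eq_bary] at h5
    have := T.B_pos i
    have := T.B_lt_A i
    nlinarith [mul_nonneg (show 0 ≤ T.A i by linarith) (neg_nonneg.2 h2),
      mul_nonneg (T.B_pos i).le (neg_nonneg.2 h3)]
  have := T.bary_add 0 x
  linarith [key 0, key (0 + 1), key (0 + 2)]

lemma isCompact_slack_ge {ε : ℝ} (hε : 0 ≤ ε) : IsCompact {x | ∀ i, ε ≤ T.slack i x} := by
  refine T.isCompact.of_isClosed_subset ?_ fun x hx i => ?_
  · have : {x | ∀ i, ε ≤ T.slack i x} = ⋂ i, {x | ε ≤ T.slack i x} := by ext; simp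
    rw [this]
    exact isClosed_iInter fun i => isClosed_le continuous_const (T.continuous_slack i)
  · exact nonneg_of_mul_nonneg_right (hε.trans (hx i)) (T.κ_pos i)

/-- The depth of a point in the three splits is bounded below away from the boundary. -/
lemma exists_uniform_depth {ε : ℝ} (hε : 0 < ε) :
    ∃ w > 0, w < 1 ∧ ∀ x, (∀ i, ε ≤ T.slack i x) → ∃ i, w ≤ T.bary i x ∧ T.bary i x ≤ 1 - w := by
  rcases Set.eq_empty_or_nonempty {x | ∀ i, ε ≤ T.slack i x} with he | hne
  · exact ⟨1 / 2, by norm_num, by norm_num, fun x hx => absurd (show x ∈ {x | ∀ i, ε ≤ T.slack i x} from hx)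
      (by rw [he]; simp)⟩
  -- The depth in the best of the three splits; its minimum on the compact set serves as `w`.
  let g : (Fin p → ℝ) → ℝ := fun x =>
    max (min (T.bary 0 x) (1 - T.bary 0 x))
      (max (min (T.bary 1 x) (1 - T.bary 1 x)) (min (T.bary 2 x) (1 - T.bary 2 x)))
  have hg : Continuous g := by
    have h0 := T.continuous_bary 0
    have h1 := T.continuous_bary 1
    have h2 := T.continuous_bary 2
    fun_prop
  obtain ⟨x₀, hx₀, hmin⟩ := (T.isCompact_slack_ge hε.le).exists_isMinOn hne hg.continuousOn
  refine ⟨g x₀, ?_, ?_, fun x hx => ?_⟩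
  · obtain ⟨i, hi0, hi1⟩ := T.exists_bary_mem_Ioo fun i => hε.trans_le (hx₀ i)
    have : 0 < min (T.bary i x₀) (1 - T.bary i x₀) := lt_min hi0 (by linarith)
    fin_cases i
    · exact this.trans_le (le_max_left _ _)
    · exact this.trans_le ((le_max_left _ _).trans (le_max_right _ _))
    · exact this.trans_le ((le_max_right _ _).trans (le_max_right _ _))
  · have hlt : ∀ a : ℝ, min a (1 - a) < 1 := fun a => by
      rcases le_total a (1 / 2) with h | h
      · exact (min_le_left _ _).trans_lt (by linarith)
      · exact (min_le_right _ _).trans_lt (by linarith)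
    exact max_lt (hlt _) (max_lt (hlt _) (hlt _))
  · have h : g x₀ ≤ g x := hmin hx
    rcases le_max_iff.1 h with h | h
    · exact ⟨0, (le_min_iff.1 h).1, by linarith [(le_min_iff.1 h).2]⟩
    rcases le_max_iff.1 h with h | h
    · exact ⟨1, (le_min_iff.1 h).1, by linarith [(le_min_iff.1 h).2]⟩
    · exact ⟨2, (le_min_iff.1 h).1, by linarith [(le_min_iff.1 h).2]⟩

/-- The potential `∑ λᵢ²`. -/
def potential (x : Fin p → ℝ) : ℝ := ∑ i, T.bary i x ^ 2

lemma potential_nonneg (x : Fin p → ℝ) : 0 ≤ T.potential x :=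
  Finset.sum_nonneg fun _ _ => sq_nonneg _

/-- Averaging loses exactly t(1 - t)(λⱼ u - λⱼ v)² in each λⱼ²; the coordinate j = i alone accounts
for t(1 - t). -/
lemma potential_comb_le {u v : Fin p → ℝ} {i : Fin 3} (hu : T.bary i u = 0) (hv : T.bary i v = 1)
    {t : ℝ} (h0 : 0 ≤ t) (h1 : t ≤ 1) :
    T.potential ((1 - t) • u + t • v) + t * (1 - t) ≤
      (1 - t) * T.potential u + t * T.potential v := by
  have e : (1 - t) * T.potential u + t * T.potential v - T.potential ((1 - t) • u + t • v)
      = ∑ j, t * (1 - t) * (T.bary j u - T.bary j v) ^ 2 := by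
    unfold potential
    rw [Finset.mul_sum, Finset.mul_sum, ← Finset.sum_add_distrib, ← Finset.sum_sub_distrib]
    refine Finset.sum_congr rfl fun j _ => ?_
    rw [T.bary_comb j u v (by ring : (1 - t) + t = 1)]
    ring
  have h := Finset.single_le_sum (f := fun j => t * (1 - t) * (T.bary j u - T.bary j v) ^ 2)
    (fun j _ => mul_nonneg (mul_nonneg h0 (by linarith)) (sq_nonneg _)) (Finset.mem_univ i)
  simp only [hu, hv] at h
  linarith

/-! ### Finite convergence of the split closures for a cyclic triangle. -/

section Convergence

variable {S : Set ((Fin p → ℝ) × (Fin q → ℝ))} {ζ : (Fin q → ℝ) →ₗ[ℝ] ℝ}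

lemma one_le_of_slack_nonpos (hS : Convex ℝ S) (hζ : ∀ z ∈ S, ∀ i, 1 - T.slack i z.1 ≤ ζ z.2)
    {n : ℕ} {z : (Fin p → ℝ) × (Fin q → ℝ)} (hz : z ∈ iterSplitClosure S n) {i : Fin 3}
    (hi : T.slack i z.1 ≤ 0) : 1 ≤ ζ z.2 := by
  have := hζ z (iterSplitClosure_antitone hS (Nat.zero_le n) hz) i
  linarith

lemma slack_pos (hS : Convex ℝ S) (hζ : ∀ z ∈ S, ∀ i, 1 - T.slack i z.1 ≤ ζ z.2)
    {n : ℕ} {z : (Fin p → ℝ) × (Fin q → ℝ)} (hz : z ∈ iterSplitClosure S n)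
    (h1 : ζ z.2 < 1) (i : Fin 3) : 0 < T.slack i z.1 := by
  by_contra! h
  exact absurd (T.one_le_of_slack_nonpos hS hζ hz h) (not_le.2 h1)

/-- If `m` is a lower bound, then after `j` more rounds the points with small value have small
potential. -/
lemma potential_le_of_lt (hS : Convex ℝ S) (hζ : ∀ z ∈ S, ∀ i, 1 - T.slack i z.1 ≤ ζ z.2)
    {ε w Ψ : ℝ} (hw : 0 < w) (hw1 : w < 1)
    (hdepth : ∀ x, (∀ i, ε ≤ T.slack i x) → ∃ i, w ≤ T.bary i x ∧ T.bary i x ≤ 1 - w)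
    (hΨ : ∀ x, (∀ i, ε ≤ T.slack i x) → T.potential x ≤ Ψ)
    {n : ℕ} {m : ℝ} (hm : ∀ z ∈ iterSplitClosure S n, m ≤ ζ z.2) (hmε : m < 1 - ε) (j : ℕ) :
    ∀ z ∈ iterSplitClosure S (n + j), ζ z.2 < m + w ^ j * (1 - ε - m) →
      (∀ i, ε ≤ T.slack i z.1) ∧ T.potential z.1 ≤ Ψ - j * w ^ 2 := by
  have slk : ∀ (k : ℕ), ∀ z ∈ iterSplitClosure S k, ζ z.2 < 1 - ε → ∀ i, ε ≤ T.slack i z.1 := by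
    intro k z hz hlt i
    have := hζ z (iterSplitClosure_antitone hS (Nat.zero_le _) hz) i
    linarith
  induction j with
  | zero =>
    intro z hz hlt
    have h := slk _ z hz (by simpa using hlt)
    exact ⟨h, by simpa using hΨ _ h⟩
  | succ j ih =>
    intro z hz hlt
    have hg : 0 < 1 - ε - m := by linarith
    have hmz : m ≤ ζ z.2 := hm z (iterSplitClosure_antitone hS (Nat.le_add_right _ _) hz)
    -- Both ends of the decomposition carry weight at least `w` and value at least `m`, so going
    -- back one round enlarges the gap above `m` by a factor of at most `1 / w`.
    have hsmall : ∀ y : (Fin p → ℝ) × (Fin q → ℝ), ∀ a b M : ℝ, w ≤ a → 0 ≤ b → m ≤ ζ y.2 →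
        m ≤ M → ζ z.2 - m = a * (ζ y.2 - m) + b * (M - m) →
        ζ y.2 < m + w ^ j * (1 - ε - m) := by
      intro y a b M ha hb hy hM e
      by_contra! hge
      have h1 : w * (w ^ j * (1 - ε - m)) ≤ a * (ζ y.2 - m) :=
        mul_le_mul ha (by linarith) (by positivity) (hw.le.trans ha)
      have h2 : 0 ≤ b * (M - m) := mul_nonneg hb (by linarith)
      rw [pow_succ] at hlt
      nlinarith
    have hpow : w ^ (j + 1) ≤ 1 := pow_le_one₀ hw.le hw1.le
    have hT := slk _ z hz (by nlinarith)
    refine ⟨hT, ?_⟩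
    obtain ⟨i, hi0, hi1⟩ := hdepth z.1 hT
    obtain ⟨u, hu, v, hv, hu0, hv1, e⟩ := exists_comb_of_mem_succ hS (n := n + j) hz
      (T.π i) (T.π₀ i) (lt_of_lt_of_le hw hi0) (lt_of_le_of_lt hi1 (by linarith))
    change z = (1 - T.bary i z.1) • u + T.bary i z.1 • v at e
    set t := T.bary i z.1
    have hmu := hm u (iterSplitClosure_antitone hS (Nat.le_add_right _ _) hu)
    have hmv := hm v (iterSplitClosure_antitone hS (Nat.le_add_right _ _) hv)
    have e2 : ζ z.2 = (1 - t) * ζ u.2 + t * ζ v.2 := by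
      conv_lhs => rw [e]
      simp
    have hu' := (ih u hu (hsmall u (1 - t) t (ζ v.2) (by linarith) (by linarith) hmu hmv
      (by rw [e2]; ring))).2
    have hv' := (ih v hv (hsmall v t (1 - t) (ζ u.2) (by linarith) (by linarith) hmv hmu
      (by rw [e2]; ring))).2
    have hp := T.potential_comb_le (u := u.1) (v := v.1) hu0 hv1 (t := t) (by linarith)
      (by linarith)
    have e1 : z.1 = (1 - t) • u.1 + t • v.1 := by
      conv_lhs => rw [e]
      simp
    rw [← e1] at hp
    have hww : w ^ 2 ≤ t * (1 - t) := by
      rw [sq]; exact mul_le_mul hi0 (by linarith) hw.le (by linarith)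
    push_cast
    nlinarith [mul_le_mul_of_nonneg_left hu' (show 0 ≤ 1 - t by linarith),
      mul_le_mul_of_nonneg_left hv' (show 0 ≤ t by linarith)]

/-- A fixed number of rounds shrinks the gap to `1 - ε` by a fixed factor. -/
lemma exists_contraction (hS : Convex ℝ S) (hζ : ∀ z ∈ S, ∀ i, 1 - T.slack i z.1 ≤ ζ z.2)
    {ε : ℝ} (hε : 0 < ε) :
    ∃ c > 0, c ≤ 1 ∧ ∃ N : ℕ, ∀ (n : ℕ) (m : ℝ), m < 1 - ε →
      (∀ z ∈ iterSplitClosure S n, m ≤ ζ z.2) →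
      ∀ z ∈ iterSplitClosure S (n + N), m + c * (1 - ε - m) ≤ ζ z.2 := by
  obtain ⟨w, hw, hw1, hdepth⟩ := T.exists_uniform_depth hε
  have hcont : Continuous T.potential := by
    unfold potential
    exact continuous_finsetSum _ fun i _ => (T.continuous_bary i).pow 2
  obtain ⟨Ψ, hΨ⟩ := (T.isCompact_slack_ge hε.le).bddAbove_image hcont.continuousOn
  -- After `J` rounds the bound Ψ - J w² on the potential is negative, so no point with such a small
  -- value remains.
  obtain ⟨J, hJ⟩ := exists_nat_gt (Ψ / w ^ 2)
  refine ⟨w ^ J, by positivity, pow_le_one₀ hw.le hw1.le, J, fun n m hmε hm z hz => ?_⟩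
  by_contra! hlt
  have h := (T.potential_le_of_lt hS hζ hw hw1 hdepth
    (fun x hx => hΨ (Set.mem_image_of_mem _ hx)) hm hmε J z hz hlt).2
  rw [div_lt_iff₀ (by positivity)] at hJ
  linarith [T.potential_nonneg z.1]

/-- The minimum of the functional over the split closures converges to a value at least `1`. -/
lemma exists_lower_bound (hS : Convex ℝ S) (hζ : ∀ z ∈ S, ∀ i, 1 - T.slack i z.1 ≤ ζ z.2)
    (hζ0 : ∀ z ∈ S, 0 ≤ ζ z.2) {ε : ℝ} (hε : 0 < ε) :
    ∃ n, ∀ z ∈ iterSplitClosure S n, 1 - ε ≤ ζ z.2 := by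
  -- Contracting towards 1 - ε/2 reaches 1 - ε after finitely many rounds; the iteration starts from
  -- the bound 0.
  obtain ⟨c, hc0, hc1, N, hN⟩ := T.exists_contraction hS hζ (half_pos hε)
  by_contra! hno
  have key : ∀ j : ℕ, ∀ z ∈ iterSplitClosure S (j * N),
      (1 - ε / 2) - (1 - c) ^ j * (1 - ε / 2) ≤ ζ z.2 := by
    intro j
    induction j with
    | zero =>
      intro z hz
      simpa using hζ0 z (iterSplitClosure_antitone hS (Nat.zero_le _) hz)
    | succ j ih =>
      have hlt : (1 - ε / 2) - (1 - c) ^ j * (1 - ε / 2) < 1 - ε / 2 := by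
        by_contra! hge
        obtain ⟨z, hz, hz1⟩ := hno (j * N)
        linarith [ih z hz]
      intro z hz
      have h := hN (j * N) _ hlt ih z (by rwa [Nat.succ_mul] at hz)
      refine le_trans (le_of_eq ?_) h
      ring
  have hlim : Filter.Tendsto (fun j : ℕ => (1 - c) ^ j * (1 - ε / 2)) Filter.atTop (nhds 0) := by
    simpa using (tendsto_pow_atTop_nhds_zero_of_lt_one (by linarith) (by linarith)
      : Filter.Tendsto (fun j : ℕ => (1 - c) ^ j) _ _).mul_const (1 - ε / 2)
  obtain ⟨j, hj⟩ := (hlim.eventually_lt_const (half_pos hε)).exists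
  obtain ⟨z, hz, hz1⟩ := hno (j * N)
  linarith [key j z hz]

lemma exists_pos_le (g : Fin 3 → ℝ) (hg : ∀ i, 0 < g i) : ∃ δ > 0, ∀ i, δ ≤ g i := by
  obtain ⟨i, hi⟩ := Finite.exists_min g
  exact ⟨g i, hg i, hi⟩

/-- Splits parallel to the sides turn a lower bound into a bound with small slope. -/
lemma exists_slope_bound (hS : Convex ℝ S) (hζ : ∀ z ∈ S, ∀ i, 1 - T.slack i z.1 ≤ ζ z.2)
    (hζ0 : ∀ z ∈ S, 0 ≤ ζ z.2) {δ : ℝ} (hδ : 0 < δ) :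
    ∃ n, ∀ z ∈ iterSplitClosure S n, ∀ i, 0 ≤ T.slack i z.1 →
      1 - δ * T.slack i z.1 ≤ ζ z.2 := by
  obtain ⟨μ, hμ, hμκ⟩ := exists_pos_le T.κ T.κ_pos
  -- On the line where the integral form is 1 the slack is κᵢ ≥ μ, so 1 - δμ ≥ 1 - δκᵢ there. On the
  -- side itself ζ ≥ 1, and the split between the two lines interpolates linearly.
  obtain ⟨n, hn⟩ := T.exists_lower_bound hS hζ hζ0 (mul_pos hδ hμ)
  refine ⟨n + 1, fun z hz i hi => ?_⟩
  set θ := latForm (T.ρ i) (T.ρ₀ i) z.1 with hθ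
  have hs : T.slack i z.1 = T.κ i * θ := rfl
  have hκ := T.κ_pos i
  have hθ0 : 0 ≤ θ := nonneg_of_mul_nonneg_right hi hκ
  have hκθ : δ * μ * θ ≤ δ * (T.κ i * θ) := by
    rw [mul_assoc]; gcongr; exact hμκ i
  rcases hθ0.eq_or_lt with h0 | h0
  · have := T.one_le_of_slack_nonpos hS hζ hz (i := i) (by rw [hs, ← h0, mul_zero])
    rw [hs, ← h0]; linarith
  rcases lt_or_ge θ 1 with h1 | h1
  · obtain ⟨u, hu, v, hv, hu0, hv1, e⟩ := exists_comb_of_mem_succ hS hz _ _ h0 h1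
    rw [← hθ] at e
    have hζu := T.one_le_of_slack_nonpos hS hζ hu (i := i) (by simp [slack, hu0])
    have e2 : ζ z.2 = (1 - θ) * ζ u.2 + θ * ζ v.2 := by
      conv_lhs => rw [e]
      simp
    have h2 := mul_le_mul_of_nonneg_left hζu (show 0 ≤ 1 - θ by linarith)
    have h3 := mul_le_mul_of_nonneg_left (hn v hv) h0.le
    rw [hs, e2]
    linarith
  · have := hn z (iterSplitClosure_antitone hS n.le_succ hz)
    have : δ * μ ≤ δ * μ * θ := le_mul_of_one_le_right (by positivity) h1
    rw [hs]; linarith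

/-- After finitely many rounds the inequality holds over the lines through two of the three integer
points. -/
lemma exists_one_le_of_bary_eq_zero (hS : Convex ℝ S)
    (hζ : ∀ z ∈ S, ∀ i, 1 - T.slack i z.1 ≤ ζ z.2) (hζ0 : ∀ z ∈ S, 0 ≤ ζ z.2) :
    ∃ n, ∀ z ∈ iterSplitClosure S n, ∀ i, T.bary i z.1 = 0 → 1 ≤ ζ z.2 := by
  have hD : ∀ i, 0 < T.A i - T.B i := fun i => by linarith [T.B_lt_A i]
  obtain ⟨δ₁, hδ₁, h1⟩ := exists_pos_le (fun i => (T.A i - T.B i) / T.B (i + 2))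
    fun i => div_pos (hD i) (T.B_pos _)
  obtain ⟨δ₂, hδ₂, h2⟩ := exists_pos_le (fun i => T.B (i + 2) / (T.A i - T.B i))
    fun i => div_pos (T.B_pos _) (hD i)
  obtain ⟨n, hn⟩ := T.exists_slope_bound hS hζ hζ0 (lt_min hδ₁ hδ₂)
  have hδ := lt_min hδ₁ hδ₂
  set δ := min δ₁ δ₂
  have h1' : ∀ i, δ * T.B (i + 2) ≤ T.A i - T.B i := fun i =>
    (le_div_iff₀ (T.B_pos _)).1 ((min_le_left _ _).trans (h1 i))
  have h2' : ∀ i, δ * (T.A i - T.B i) ≤ T.B (i + 2) := fun i =>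
    (le_div_iff₀ (hD i)).1 ((min_le_right _ _).trans (h2 i))
  have main : ∀ z ∈ iterSplitClosure S (n + 1), ∀ i, T.bary (i + 1) z.1 = 0 → 1 ≤ ζ z.2 := by
    intro z hz i h0
    have hsum := T.bary_add i z.1
    have hBi := T.B_pos i
    have hB2 := T.B_pos (i + 2)
    have hAi := T.B_lt_A i
    have hA2 := T.B_lt_A (i + 2)
    -- On the line λᵢ₊₁ = 0 the slacks are ℓᵢ₊₂ = Aᵢ₊₂ λᵢ and ℓᵢ = Bᵢ (1 - λᵢ), so outside 0 < λᵢ <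
    -- 1 the point is not interior.
    rcases le_or_gt (T.bary i z.1) 0 with ht | ht
    · refine T.one_le_of_slack_nonpos hS hζ hz (i := i + 2) ?_
      rw [slack_add_two, h0]
      nlinarith
    rcases le_or_gt 1 (T.bary i z.1) with ht1 | ht1
    · refine T.one_le_of_slack_nonpos hS hζ hz (i := i) ?_
      rw [slack_eq_bary, h0]
      nlinarith
    obtain ⟨u, hu, v, hv, hu0, hv1, e⟩ := exists_comb_of_mem_succ hS hz _ _ ht ht1
    change z = (1 - T.bary i z.1) • u + T.bary i z.1 • v at e
    change T.bary i u.1 = 0 at hu0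
    change T.bary i v.1 = 1 at hv1
    set t := T.bary i z.1
    have e2 : ζ z.2 = (1 - t) * ζ u.2 + t * ζ v.2 := by
      conv_lhs => rw [e]
      simp
    have e1 : z.1 = (1 - t) • u.1 + t • v.1 := by
      conv_lhs => rw [e]
      simp
    rw [e1, T.bary_comb _ _ _ (by ring : (1 - t) + t = 1)] at h0
    set a := T.bary (i + 1) u.1
    set b := T.bary (i + 1) v.1
    have su : T.slack (i + 2) u.1 = T.B (i + 2) * a := by
      rw [slack_add_two, hu0]; ring
    have sv : T.slack i v.1 = (T.A i - T.B i) * b := by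
      have := T.bary_add i v.1
      rw [slack_eq_bary, show T.bary (i + 2) v.1 = -b by linarith]; ring
    have hu' := hζ u (iterSplitClosure_antitone hS (Nat.zero_le _) hu) (i + 2)
    have hv' := hζ v (iterSplitClosure_antitone hS (Nat.zero_le _) hv) i
    have hu'' := hn u hu (i + 2)
    have hv'' := hn v hv i
    rw [su] at hu' hu''
    rw [sv] at hv' hv''
    have ht' : 0 < 1 - t := by linarith
    rw [e2]
    -- Since (1 - t)a + tb = 0, either ℓᵢ(v) ≤ 0 or ℓᵢ₊₂(u) < 0. That end gains with slope 1 while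
    -- the other loses with slope δ; `h1'` and `h2'` say that the gain covers the loss.
    rcases le_or_gt 0 a with ha | ha
    · have k1 := mul_le_mul_of_nonneg_left (hu'' (mul_nonneg hB2.le ha)) ht'.le
      have k2 := mul_le_mul_of_nonneg_left hv' ht.le
      have k3 := mul_nonneg (mul_nonneg ht'.le ha) (sub_nonneg.2 (h1' i))
      have k4 : t * b = -((1 - t) * a) := by linarith
      linear_combination k1 + k2 + k3 + (T.A i - T.B i) * k4
    · have hb0 : 0 ≤ b := by
        by_contra! hb0
        nlinarith [mul_pos ht' (neg_pos.2 ha), mul_pos ht (neg_pos.2 hb0)]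
      have k1 := mul_le_mul_of_nonneg_left hu' ht'.le
      have k2 := mul_le_mul_of_nonneg_left (hv'' (mul_nonneg (hD i).le hb0)) ht.le
      have k3 := mul_nonneg (mul_nonneg ht.le hb0) (sub_nonneg.2 (h2' i))
      have k4 : (1 - t) * a = -(t * b) := by linarith
      linear_combination k1 + k2 + k3 + T.B (i + 2) * k4
  refine ⟨n + 1, fun z hz i hi => main z hz (i + 2) ?_⟩
  rw [add_assoc, show i + (2 + 1) = i from by fin_cases i <;> rfl]
  exact hi

/-- The inequality becomes valid after finitely many rounds. -/
theorem exists_one_le (hS : Convex ℝ S) (hζ : ∀ z ∈ S, ∀ i, 1 - T.slack i z.1 ≤ ζ z.2)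
    (hζ0 : ∀ z ∈ S, 0 ≤ ζ z.2) : ∃ n, ∀ z ∈ iterSplitClosure S n, 1 ≤ ζ z.2 := by
  obtain ⟨n, hn⟩ := T.exists_one_le_of_bary_eq_zero hS hζ hζ0
  -- Otherwise the segment from `u` to `v` meets the line λᵢ = 0 with value below 1.
  have sign : ∀ u ∈ iterSplitClosure S n, ∀ v ∈ iterSplitClosure S n, ζ u.2 < 1 → ζ v.2 < 1 →
      ∀ i, 0 < T.bary i u.1 → 0 < T.bary i v.1 := by
    intro u hu v hv hu1 hv1 i hi
    by_contra! hle
    set a := T.bary i u.1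
    set b := T.bary i v.1
    have hab : 0 < a - b := by linarith
    have hsum : -b / (a - b) + a / (a - b) = 1 := by field_simp; ring
    have c1 : 0 ≤ -b / (a - b) := div_nonneg (by linarith) hab.le
    have c2 : 0 < a / (a - b) := div_pos hi hab
    have h := hn _ (convex_iterSplitClosure hS n hu hv c1 c2.le hsum) i (by
      change T.bary i ((-b / (a - b)) • u.1 + (a / (a - b)) • v.1) = 0
      rw [T.bary_comb _ _ _ hsum]
      change -b / (a - b) * a + a / (a - b) * b = 0
      field_simp; ring)
    simp only [Prod.snd_add, Prod.smul_snd, map_add, map_smul, smul_eq_mul] at h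
    nlinarith [mul_nonneg c1 (sub_nonneg.2 hu1.le), mul_pos c2 (sub_pos.2 hv1)]
  -- The end with λᵢ = 0 has ζ ≥ 1, so the deficit lies at `v`, where λᵢ = 1 and 0 < ℓᵢ = (Aᵢ - Bᵢ)
  -- λᵢ₊₁.
  have step : ∀ z ∈ iterSplitClosure S (n + 1), ζ z.2 < 1 → ∀ i, 0 < T.bary i z.1 →
      T.bary i z.1 < 1 → ∃ v ∈ iterSplitClosure S n, ζ v.2 < 1 ∧ 0 < T.bary (i + 1) v.1 ∧
        T.bary (i + 2) v.1 < 0 := by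
    intro z hz hz1 i h0 h1
    obtain ⟨u, hu, v, hv, hu0, hv1, e⟩ := exists_comb_of_mem_succ hS hz _ _ h0 h1
    change z = (1 - T.bary i z.1) • u + T.bary i z.1 • v at e
    change T.bary i v.1 = 1 at hv1
    have hζu := hn u hu i hu0
    set t := T.bary i z.1
    have e2 : ζ z.2 = (1 - t) * ζ u.2 + t * ζ v.2 := by
      conv_lhs => rw [e]
      simp
    have hζv : ζ v.2 < 1 := by
      by_contra! hge
      nlinarith
    have hs := T.slack_pos hS hζ hv hζv i
    have hsum := T.bary_add i v.1
    rw [slack_eq_bary, show T.bary (i + 2) v.1 = -T.bary (i + 1) v.1 by linarith] at hs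
    have hpos : 0 < T.bary (i + 1) v.1 := by
      have := T.B_lt_A i
      by_contra! hle
      nlinarith
    exact ⟨v, hv, hζv, hpos, by linarith⟩
  refine ⟨n + 1, fun z hz => ?_⟩
  by_contra! hz1
  have hzn := iterSplitClosure_antitone hS n.le_succ hz
  have hslack := T.slack_pos hS hζ hz hz1
  obtain ⟨i, hi0, hi1⟩ := T.exists_bary_mem_Ioo hslack
  obtain ⟨v, hv, hζv, hv1, hv2⟩ := step z hz hz1 i hi0 hi1
  have hz2 := sign v hv z hzn hζv hz1 _ hv1
  -- The next split yields a point with λᵢ₊₂ > 0, while λᵢ₊₂ < 0 at `v`.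
  obtain ⟨v', hv', hζv', hv1', -⟩ := step z hz hz1 (i + 1) hz2 (T.bary_lt_one hslack hi0.le)
  rw [add_assoc, show i + (1 + 1) = i + 2 from rfl] at hv1'
  exact absurd (sign v' hv' v hv hζv' hζv _ hv1') (not_lt.2 hv2.le)

end Convergence
end CyclicTriangle
end SplitRank

/-! ### Integer triangles: unimodularity and cyclic order of the slacks. -/

namespace SplitRank

/-- An integer point as a real point. -/
def intPoint {p : ℕ} (z : Fin p → ℤ) : Fin p → ℝ := fun j => (z j : ℝ)

lemma affineMap_fin_two (g : (Fin 2 → ℝ) →ᵃ[ℝ] ℝ) :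
    ∃ a b c : ℝ, ∀ x, g x = a * x 0 + b * x 1 + c := by
  refine ⟨g.linear (Pi.single 0 1), g.linear (Pi.single 1 1), g 0, fun x => ?_⟩
  have hx : x = x 0 • Pi.single 0 1 + x 1 • Pi.single 1 1 := by
    ext j; fin_cases j <;> simp
  have h := g.map_vadd 0 x
  rw [vadd_eq_add, add_zero, vadd_eq_add] at h
  rw [h]
  conv_lhs => rw [hx]
  simp only [map_add, map_smul, smul_eq_mul]
  ring

/-- Twice the signed area of an integer triangle. -/
def area (y : Fin 3 → Fin 2 → ℤ) : ℤ :=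
  (y 1 0 - y 0 0) * (y 2 1 - y 0 1) - (y 1 1 - y 0 1) * (y 2 0 - y 0 0)

/-- Twice the signed area of the triangle with vertices `x`, `yᵢ₊₁`, `yᵢ₊₂`. -/
def subArea (y : Fin 3 → Fin 2 → ℤ) (i : Fin 3) (x : Fin 2 → ℝ) : ℝ :=
  ((y (i + 1) 0 : ℝ) - x 0) * ((y (i + 2) 1 : ℝ) - x 1)
    - ((y (i + 1) 1 : ℝ) - x 1) * ((y (i + 2) 0 : ℝ) - x 0)

lemma fin_three_idx : (1 + 1 : Fin 3) = 2 ∧ (1 + 2 : Fin 3) = 0 ∧ (2 + 1 : Fin 3) = 0 ∧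
    (2 + 2 : Fin 3) = 1 := by decide

lemma sum_subArea (y : Fin 3 → Fin 2 → ℤ) (x : Fin 2 → ℝ) : ∑ i, subArea y i x = area y := by
  obtain ⟨h1, h2, h3, h4⟩ := fin_three_idx
  simp only [Fin.sum_univ_three, subArea, area, zero_add, h1, h2, h3, h4]
  push_cast; ring

lemma area_mul_apply (y : Fin 3 → Fin 2 → ℤ) (g : (Fin 2 → ℝ) →ᵃ[ℝ] ℝ) (x : Fin 2 → ℝ) :
    (area y : ℝ) * g x = ∑ i, subArea y i x * g (intPoint (y i)) := by
  obtain ⟨h1, h2, h3, h4⟩ := fin_three_idx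
  obtain ⟨a, b, c, h⟩ := affineMap_fin_two g
  simp only [Fin.sum_univ_three, subArea, area, zero_add, h1, h2, h3, h4, h, intPoint]
  push_cast; ring

section Triangle

variable {y : Fin 3 → Fin 2 → ℤ} {g : Fin 3 → (Fin 2 → ℝ) →ᵃ[ℝ] ℝ}

/-- Barycentric interpolation with the area not divided out; the term of `y i` drops because `g i`
vanishes there. -/
lemma subArea_eq (h0 : ∀ i, g i (intPoint (y i)) = 0) (i : Fin 3) (x : Fin 2 → ℝ) :
    (area y : ℝ) * g i x = subArea y (i + 1) x * g i (intPoint (y (i + 1)))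
      + subArea y (i + 2) x * g i (intPoint (y (i + 2))) := by
  rw [area_mul_apply, Fin.sum_univ_three]
  obtain ⟨h1, h2, h3, h4⟩ := fin_three_idx
  fin_cases i
  · simp [h0 0]
  · simp [h0 1, h1, h2]; ring
  · simp [h0 2, h3, h4]

lemma pos_of_ne (h1 : ∀ i, 0 < g i (intPoint (y (i + 1))))
    (h2 : ∀ i, 0 < g i (intPoint (y (i + 2)))) {i j : Fin 3} (hij : j ≠ i) :
    0 < g i (intPoint (y j)) := by
  have : j = i + 1 ∨ j = i + 2 := by revert i j; decide
  rcases this with rfl | rfl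
  · exact h1 i
  · exact h2 i

lemma injective_of_slack (h0 : ∀ i, g i (intPoint (y i)) = 0)
    (h1 : ∀ i, 0 < g i (intPoint (y (i + 1)))) (h2 : ∀ i, 0 < g i (intPoint (y (i + 2)))) :
    Function.Injective y := by
  intro i j hij
  by_contra hne
  have := pos_of_ne h1 h2 (Ne.symm hne)
  rw [← hij, h0] at this
  exact lt_irrefl _ this

/-- With zero area, `subArea_eq` makes any two of the three subareas vanish together or have
opposite signs. Three numbers allow this only if all vanish, identically in `x`, and then two of the
points coincide. -/
lemma area_ne_zero (h0 : ∀ i, g i (intPoint (y i)) = 0)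
    (h1 : ∀ i, 0 < g i (intPoint (y (i + 1)))) (h2 : ∀ i, 0 < g i (intPoint (y (i + 2)))) :
    area y ≠ 0 := by
  intro hD
  have key : ∀ i x, subArea y (i + 1) x * g i (intPoint (y (i + 1)))
      + subArea y (i + 2) x * g i (intPoint (y (i + 2))) = 0 := by
    intro i x
    rw [← subArea_eq h0, hD, Int.cast_zero, zero_mul]
  have idx : ∀ i : Fin 3, i + 1 + 1 = i + 2 ∧ i + 1 + 2 = i ∧ i + 2 + 1 = i ∧ i + 2 + 2 = i + 1 := by
    decide
  have hle : ∀ i x, subArea y i x ≤ 0 := by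
    intro i x
    by_contra! hpos
    obtain ⟨e1, e2, e3, e4⟩ := idx i
    have k1 := key (i + 1) x
    have k2 := key (i + 2) x
    have k0 := key i x
    rw [e1, e2] at k1
    rw [e3, e4] at k2
    have a1 := h1 (i + 1)
    have a2 := h2 (i + 1)
    have b1 := h1 (i + 2)
    have b2 := h2 (i + 2)
    rw [e1] at a1
    rw [e2] at a2
    rw [e3] at b1
    rw [e4] at b2
    have m1 : subArea y (i + 2) x < 0 := by
      by_contra! h
      linarith [mul_pos hpos a2, mul_nonneg h a1.le]
    have m2 : subArea y (i + 1) x < 0 := by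
      by_contra! h
      linarith [mul_pos hpos b1, mul_nonneg h b2.le]
    linarith [mul_pos (neg_pos.2 m1) (h2 i), mul_pos (neg_pos.2 m2) (h1 i)]
  have hzero : ∀ x, subArea y 0 x = 0 := by
    intro x
    have hs := sum_subArea y x
    rw [hD, Fin.sum_univ_three, Int.cast_zero] at hs
    linarith [hle 0 x, hle 1 x, hle 2 x]
  have z0 := hzero ![0, 0]
  have z1 := hzero ![1, 0]
  have z2 := hzero ![0, 1]
  simp [subArea] at z0 z1 z2
  have : y 1 = y 2 := by
    ext j
    have : (y 1 j : ℝ) = y 2 j := by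
      fin_cases j
      · change (y 1 0 : ℝ) = y 2 0
        linarith
      · change (y 1 1 : ℝ) = y 2 1
        linarith
    exact_mod_cast this
  exact absurd (injective_of_slack h0 h1 h2 this) (by decide)

lemma subArea_vertex (y : Fin 3 → Fin 2 → ℤ) (i j : Fin 3) :
    subArea y i (intPoint (y j)) = if i = j then (area y : ℝ) else 0 := by
  obtain ⟨h1, h2, h3, h4⟩ := fin_three_idx
  fin_cases i <;> fin_cases j <;> simp [subArea, area, intPoint, h1, h2, h3, h4] <;> ring

/-- A triangle with integer vertices and no further integer points is unimodular. -/
lemma area_sq_eq_one (h0 : ∀ i, g i (intPoint (y i)) = 0)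
    (h1 : ∀ i, 0 < g i (intPoint (y (i + 1)))) (h2 : ∀ i, 0 < g i (intPoint (y (i + 2))))
    (hlat : ∀ z : Fin 2 → ℤ, (∀ i, 0 ≤ g i (intPoint z)) → ∃ i, z = y i) :
    area y * area y = 1 := by
  have hD := area_ne_zero h0 h1 h2
  have hDR : (area y : ℝ) ≠ 0 := by exact_mod_cast hD
  have hvert : ∀ z : Fin 2 → ℤ, (∀ i, 0 ≤ subArea y i (intPoint z) / area y) → ∃ i, z = y i := by
    intro z hz
    refine hlat z fun i => ?_
    have e : g i (intPoint z) = subArea y (i + 1) (intPoint z) / area y * g i (intPoint (y (i + 1)))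
        + subArea y (i + 2) (intPoint z) / area y * g i (intPoint (y (i + 2))) := by
      have := subArea_eq h0 i (intPoint z)
      field_simp
      linarith
    rw [e]
    exact add_nonneg (mul_nonneg (hz _) (h1 i).le) (mul_nonneg (hz _) (h2 i).le)
  have hsum : ∀ x, subArea y 0 x / area y + subArea y 1 x / area y + subArea y 2 x / area y = 1 := by
    intro x
    have := sum_subArea y x
    rw [Fin.sum_univ_three] at this
    rw [← add_div, ← add_div, this, div_self hDR]
  have hmove : ∀ (z : Fin 2 → ℤ) (a b : ℤ) (s : ℤ), ∀ i : Fin 3, i ≠ 0 →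
      subArea y i (intPoint fun j => s * (z j - y 0 j) + a * (y 1 j - y 0 j) + b * (y 2 j - y 0 j)
        + y 0 j) =
      s * subArea y i (intPoint z) + (if i = 1 then a * area y else b * area y) := by
    intro z a b s i hi
    obtain ⟨e1, e2, e3, e4⟩ := fin_three_idx
    fin_cases i
    · exact absurd rfl hi
    · simp [subArea, area, intPoint, e1, e2]; ring
    · simp [subArea, area, intPoint, e3, e4]; ring
  have hint : ∀ z : Fin 2 → ℤ, Int.fract (subArea y 1 (intPoint z) / area y) = 0 ∧
      Int.fract (subArea y 2 (intPoint z) / area y) = 0 := by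
    intro z
    set s := subArea y 1 (intPoint z) / area y with hs
    set t := subArea y 2 (intPoint z) / area y with ht
    have fs0 := Int.fract_nonneg s
    have fs1 := Int.fract_lt_one s
    have ft0 := Int.fract_nonneg t
    have ft1 := Int.fract_lt_one t
    -- Translating by edge vectors reduces `z` to the fundamental parallelogram. The result lies in
    -- the triangle or, after a point reflection, its mirror image does; hence it is a vertex.
    rcases le_or_gt (Int.fract s + Int.fract t) 1 with hle | hgt
    · set z' : Fin 2 → ℤ := fun j => 1 * (z j - y 0 j) + (-⌊s⌋) * (y 1 j - y 0 j)
        + (-⌊t⌋) * (y 2 j - y 0 j) + y 0 j with hz'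
      have e1 : subArea y 1 (intPoint z') / area y = Int.fract s := by
        rw [hz', hmove z _ _ _ 1 (by decide), if_pos rfl, ← Int.self_sub_floor, hs]
        push_cast; field_simp; ring
      have e2 : subArea y 2 (intPoint z') / area y = Int.fract t := by
        rw [hz', hmove z _ _ _ 2 (by decide), if_neg (by decide), ← Int.self_sub_floor, ht]
        push_cast; field_simp; ring
      obtain ⟨i, hi⟩ := hvert z' fun i => by
        have := hsum (intPoint z')
        fin_cases i
        · change 0 ≤ subArea y 0 _ / _
          linarith
        · exact e1.symm ▸ fs0
        · exact e2.symm ▸ ft0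
      rw [hi, subArea_vertex] at e1 e2
      constructor
      · by_contra hne
        by_cases h : (1 : Fin 3) = i
        · rw [if_pos h, div_self hDR] at e1; linarith
        · rw [if_neg h, zero_div] at e1; exact hne e1.symm
      · by_contra hne
        by_cases h : (2 : Fin 3) = i
        · rw [if_pos h, div_self hDR] at e2; linarith
        · rw [if_neg h, zero_div] at e2; exact hne e2.symm
    · exfalso
      set z' : Fin 2 → ℤ := fun j => (-1) * (z j - y 0 j) + (⌊s⌋ + 1) * (y 1 j - y 0 j)
        + (⌊t⌋ + 1) * (y 2 j - y 0 j) + y 0 j with hz'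
      have e1 : subArea y 1 (intPoint z') / area y = 1 - Int.fract s := by
        rw [hz', hmove z _ _ _ 1 (by decide), if_pos rfl, ← Int.self_sub_floor, hs]
        push_cast; field_simp; ring
      have e2 : subArea y 2 (intPoint z') / area y = 1 - Int.fract t := by
        rw [hz', hmove z _ _ _ 2 (by decide), if_neg (by decide), ← Int.self_sub_floor, ht]
        push_cast; field_simp; ring
      obtain ⟨i, hi⟩ := hvert z' fun i => by
        have := hsum (intPoint z')
        fin_cases i
        · change 0 ≤ subArea y 0 _ / _
          linarith
        · change 0 ≤ subArea y 1 _ / _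
          linarith
        · change 0 ≤ subArea y 2 _ / _
          linarith
      rw [hi, subArea_vertex] at e1 e2
      by_cases h : (1 : Fin 3) = i
      · rw [if_neg (by rw [← h]; decide), zero_div] at e2; linarith
      · rw [if_neg h, zero_div] at e1; linarith
  have hdvd : ∀ z : Fin 2 → ℤ,
      (∃ n : ℤ, subArea y 1 (intPoint z) = n * area y) ∧
      ∃ n : ℤ, subArea y 2 (intPoint z) = n * area y := by
    intro z
    obtain ⟨a, b⟩ := hint z
    refine ⟨⟨⌊subArea y 1 (intPoint z) / area y⌋, ?_⟩,
      ⟨⌊subArea y 2 (intPoint z) / area y⌋, ?_⟩⟩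
    · have := Int.floor_add_fract (subArea y 1 (intPoint z) / area y)
      rw [a, add_zero] at this
      rw [this]; field_simp
    · have := Int.floor_add_fract (subArea y 2 (intPoint z) / area y)
      rw [b, add_zero] at this
      rw [this]; field_simp
  -- Testing on `y 0` plus the two unit vectors shows that the area divides every coordinate of the
  -- edge vectors, so its square divides the area.
  obtain ⟨⟨n1, e1⟩, ⟨n2, e2⟩⟩ := hdvd fun j => y 0 j + if j = 0 then 1 else 0
  obtain ⟨⟨n3, e3⟩, ⟨n4, e4⟩⟩ := hdvd fun j => y 0 j + if j = 0 then 0 else 1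
  obtain ⟨i1, i2, i3, i4⟩ := fin_three_idx
  simp only [subArea, intPoint, i1, i2, i3, i4] at e1 e2 e3 e4
  simp at e1 e2 e3 e4
  have f1 : y 2 1 - y 0 1 = n1 * area y := by
    have : (y 2 1 : ℝ) - y 0 1 = n1 * area y := by linarith
    exact_mod_cast this
  have f2 : y 0 1 - y 1 1 = n2 * area y := by
    have : (y 0 1 : ℝ) - y 1 1 = n2 * area y := by linarith
    exact_mod_cast this
  have f3 : y 0 0 - y 2 0 = n3 * area y := by
    have : (y 0 0 : ℝ) - y 2 0 = n3 * area y := by linarith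
    exact_mod_cast this
  have f4 : y 1 0 - y 0 0 = n4 * area y := by
    have : (y 1 0 : ℝ) - y 0 0 = n4 * area y := by linarith
    exact_mod_cast this
  have hprod : area y = area y * ((n4 * n1 - n2 * n3) * area y) := by
    conv_lhs => rw [area, f1, f4, show y 1 1 - y 0 1 = -(n2 * area y) by linarith,
      show y 2 0 - y 0 0 = -(n3 * area y) by linarith]
    ring
  have hone : (n4 * n1 - n2 * n3) * area y = 1 := by
    apply mul_left_cancel₀ hD
    rw [← hprod, mul_one]
  rcases Int.isUnit_iff.1 (IsUnit.of_mul_eq_one _ ((mul_comm _ _).trans hone)) with h | h <;>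
    rw [h] <;> norm_num

/-- The slacks at the three integer points are cyclically ordered. -/
lemma slack_cyclic (h0 : ∀ i, g i (intPoint (y i)) = 0)
    (h1 : ∀ i, 0 < g i (intPoint (y (i + 1)))) (h2 : ∀ i, 0 < g i (intPoint (y (i + 2))))
    (hlat : ∀ z : Fin 2 → ℤ, (∀ i, 0 ≤ g i (intPoint z)) → ∃ i, z = y i) :
    (∀ i, g i (intPoint (y (i + 2))) < g i (intPoint (y (i + 1)))) ∨
      ∀ i, g i (intPoint (y (i + 1))) < g i (intPoint (y (i + 2))) := by
  have idx : ∀ i : Fin 3, i + 1 + 1 = i + 2 ∧ i + 1 + 2 = i ∧ i + 2 + 1 = i ∧ i + 2 + 2 = i + 1 := by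
    decide
  have hinj := injective_of_slack h0 h1 h2
  have step : ∀ i, g i (intPoint (y (i + 2))) ≤ g i (intPoint (y (i + 1))) →
      g (i + 1) (intPoint (y (i + 1 + 2))) < g (i + 1) (intPoint (y (i + 1 + 1))) := by
    intro i hi
    by_contra! hle
    obtain ⟨e1, e2, e3, e4⟩ := idx i
    rw [e1, e2] at hle
    -- If the order failed to propagate, this fourth vertex of a parallelogram would be another
    -- integer point of the triangle.
    set z : Fin 2 → ℤ := fun j => y i j + y (i + 1) j - y (i + 2) j with hz
    have hval : ∀ k, g k (intPoint z) = g k (intPoint (y i)) + g k (intPoint (y (i + 1)))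
        - g k (intPoint (y (i + 2))) := by
      intro k
      obtain ⟨a, b, c, h⟩ := affineMap_fin_two (g k)
      simp only [h, intPoint, hz]
      push_cast; ring
    obtain ⟨m, hm⟩ := hlat z fun k => by
      have hk : k = i ∨ k = i + 1 ∨ k = i + 2 := by clear * -; revert k i; decide
      rw [hval]
      rcases hk with rfl | rfl | rfl
      · rw [h0]; linarith
      · rw [h0]; linarith
      · rw [h0]
        have a1 := h1 (i + 2)
        have a2 := h2 (i + 2)
        rw [e3] at a1
        rw [e4] at a2
        linarith
    have hm' : ∀ k, g k (intPoint (y m)) = g k (intPoint (y i)) + g k (intPoint (y (i + 1)))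
        - g k (intPoint (y (i + 2))) := fun k => by rw [← hm, hval]
    have hmi : m = i ∨ m = i + 1 ∨ m = i + 2 := by clear * -; revert m i; decide
    rcases hmi with rfl | rfl | rfl
    · have := hm' (m + 1)
      rw [h0] at this
      have a1 := h1 (m + 1)
      rw [e1] at a1
      linarith
    · have := hm' i
      rw [h0] at this
      linarith [h2 i]
    · have := hm' (i + 2)
      rw [h0] at this
      have a1 := h1 (i + 2)
      have a2 := h2 (i + 2)
      rw [e3] at a1
      rw [e4] at a2
      linarith
  rcases le_or_gt (g 0 (intPoint (y (0 + 2)))) (g 0 (intPoint (y (0 + 1)))) with h | h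
  · have s1 := step 0 h
    have s2 := step 1 s1.le
    have s3 := step 2 s2.le
    left
    intro i
    fin_cases i
    · exact s3
    · exact s1
    · exact s2
  · right
    intro i
    by_contra! hle
    have s1 := step i hle
    have s2 := step (i + 1) s1.le
    have hi : i = 0 ∨ i + 1 = 0 ∨ i + 1 + 1 = 0 := by clear * -; revert i; decide
    rcases hi with e | e | e
    · rw [e] at hle; exact absurd h (not_lt.2 hle)
    · rw [e] at s1; exact lt_asymm s1 h
    · rw [e] at s2; exact lt_asymm s2 h

end Triangle
end SplitRank

/-! ### From slacks and integer points to a cyclic triangle. -/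

namespace SplitRank

section Triangle

variable {y : Fin 3 → Fin 2 → ℤ} {g : Fin 3 → (Fin 2 → ℝ) →ᵃ[ℝ] ℝ}

/-- When the area is ±1, multiplying by it is dividing by it, so this product is a barycentric
coordinate with integer coefficients. -/
lemma latForm_subArea (y : Fin 3 → Fin 2 → ℤ) (i : Fin 3) (x : Fin 2 → ℝ) :
    latForm ![area y * (y (i + 1) 1 - y (i + 2) 1), area y * (y (i + 2) 0 - y (i + 1) 0)]
      (-(area y * (y (i + 1) 0 * y (i + 2) 1 - y (i + 1) 1 * y (i + 2) 0))) x
      = area y * subArea y i x := by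
  simp [latForm, subArea]; ring

lemma exists_cyclicTriangle (h0 : ∀ i, g i (intPoint (y i)) = 0)
    (h2 : ∀ i, 0 < g i (intPoint (y (i + 2))))
    (hlt : ∀ i, g i (intPoint (y (i + 2))) < g i (intPoint (y (i + 1))))
    (harea : area y * area y = 1)
    (hrat : ∀ i, ∃ κ > 0, ∃ (ρ : Fin 2 → ℤ) (ρ₀ : ℤ), ∀ x, g i x = κ * latForm ρ ρ₀ x)
    (hcpt : IsCompact {x | ∀ i, 0 ≤ g i x}) :
    ∃ T : CyclicTriangle 2, ∀ i x, T.slack i x = g i x := by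
  choose κ hκ ρ ρ₀ hρ using hrat
  have harea' : (area y : ℝ) * area y = 1 := by exact_mod_cast harea
  refine ⟨{
    π := fun i => ![area y * (y (i + 1) 1 - y (i + 2) 1), area y * (y (i + 2) 0 - y (i + 1) 0)]
    π₀ := fun i => -(area y * (y (i + 1) 0 * y (i + 2) 1 - y (i + 1) 1 * y (i + 2) 0))
    A := fun i => g i (intPoint (y (i + 1)))
    B := fun i => g i (intPoint (y (i + 2)))
    ρ := ρ
    ρ₀ := ρ₀
    κ := κ
    sum_eq_one := fun x => ?_
    B_pos := h2
    B_lt_A := hlt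
    κ_pos := hκ
    slack_eq := fun i x => ?_
    isCompact := ?_ }, fun i x => (hρ i x).symm⟩
  · simp only [latForm_subArea]
    rw [← Finset.mul_sum, sum_subArea, harea']
  · rw [latForm_subArea, latForm_subArea, ← hρ]
    have h := subArea_eq h0 i x
    linear_combination (-(area y : ℝ)) * h + g i x * harea'
  · convert hcpt using 4 with x i
    rw [hρ, mul_nonneg_iff_of_pos_left (hκ i)]

/-- Finite convergence for a lattice-free triangle with slacks `gᵢ` whose integer points are one
point in the relative interior of each side. -/
theorem exists_one_le_of_triangle {q : ℕ} {S : Set ((Fin 2 → ℝ) × (Fin q → ℝ))}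
    {ζ : (Fin q → ℝ) →ₗ[ℝ] ℝ} (h0 : ∀ i, g i (intPoint (y i)) = 0)
    (h1 : ∀ i, 0 < g i (intPoint (y (i + 1)))) (h2 : ∀ i, 0 < g i (intPoint (y (i + 2))))
    (hlat : ∀ z : Fin 2 → ℤ, (∀ i, 0 ≤ g i (intPoint z)) → ∃ i, z = y i)
    (hrat : ∀ i, ∃ κ > 0, ∃ (ρ : Fin 2 → ℤ) (ρ₀ : ℤ), ∀ x, g i x = κ * latForm ρ ρ₀ x)
    (hcpt : IsCompact {x | ∀ i, 0 ≤ g i x})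
    (hS : Convex ℝ S) (hζ : ∀ z ∈ S, ∀ i, 1 - g i z.1 ≤ ζ z.2) (hζ0 : ∀ z ∈ S, 0 ≤ ζ z.2) :
    ∃ n, ∀ z ∈ iterSplitClosure S n, 1 ≤ ζ z.2 := by
  rcases slack_cyclic h0 h1 h2 hlat with hlt | hlt
  · obtain ⟨T, hT⟩ := exists_cyclicTriangle h0 h2 hlt (area_sq_eq_one h0 h1 h2 hlat) hrat hcpt
    exact T.exists_one_le hS (fun z hz i => by rw [hT]; exact hζ z hz i) hζ0
  -- Reindexing by `i ↦ -i` exchanges the two neighbours of each index and reverses the orientation.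
  · have e1 : ∀ i : Fin 3, -(i + 1) = -i + 2 := by decide
    have e2 : ∀ i : Fin 3, -(i + 2) = -i + 1 := by decide
    have h0' : ∀ i, g (-i) (intPoint (y (-i))) = 0 := fun i => h0 _
    have h1' : ∀ i, 0 < g (-i) (intPoint (y (-(i + 1)))) := fun i => by rw [e1]; exact h2 _
    have h2' : ∀ i, 0 < g (-i) (intPoint (y (-(i + 2)))) := fun i => by rw [e2]; exact h1 _
    have hlat' : ∀ z : Fin 2 → ℤ, (∀ i, 0 ≤ g (-i) (intPoint z)) → ∃ i, z = y (-i) := by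
      intro z hz
      obtain ⟨i, hi⟩ := hlat z fun i => by simpa using hz (-i)
      exact ⟨-i, by simpa using hi⟩
    obtain ⟨T, hT⟩ := exists_cyclicTriangle (y := fun i => y (-i)) (g := fun i => g (-i)) h0' h2'
      (fun i => by rw [e1, e2]; exact hlt _) (area_sq_eq_one (y := fun i => y (-i))
        (g := fun i => g (-i)) h0' h1' h2' hlat') (fun i => hrat _) (by
        have e : {x | ∀ i, 0 ≤ g (-i) x} = {x | ∀ i, 0 ≤ g i x} :=
          Set.ext fun x => ⟨fun h i => by simpa using h (-i), fun h i => h _⟩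
        rw [e]; exact hcpt)
    exact T.exists_one_le hS (fun z hz i => by rw [hT]; exact hζ z hz _) hζ0

end Triangle

/-! ### Rationality of lines and of solutions of linear systems. -/

/-- The subfield of rational real numbers. -/
noncomputable abbrev ratField : Subfield ℝ := (Rat.castHom ℝ).fieldRange

lemma ratCast_mem (r : ℚ) : (r : ℝ) ∈ ratField := ⟨r, rfl⟩

lemma intCast_mem_ratField (n : ℤ) : (n : ℝ) ∈ ratField := ⟨n, by simp⟩

/-- An affine form vanishing at an integer point and at two distinct points with rational
difference is a multiple of an integral affine form. -/
lemma exists_latForm_of_rational (g : (Fin 2 → ℝ) →ᵃ[ℝ] ℝ) {u v : Fin 2 → ℝ} {z : Fin 2 → ℤ}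
    (hu : g u = 0) (hv : g v = 0) (hz : g (intPoint z) = 0) (huv : u ≠ v)
    (hrat : ∀ j, u j - v j ∈ ratField) {x₀ : Fin 2 → ℝ} (hx₀ : g x₀ ≠ 0) :
    ∃ κ > 0, ∃ (ρ : Fin 2 → ℤ) (ρ₀ : ℤ), ∀ x, g x = κ * latForm ρ ρ₀ x := by
  obtain ⟨a, b, c, h⟩ := affineMap_fin_two g
  obtain ⟨r, hr⟩ := hrat 0
  obtain ⟨s, hs⟩ := hrat 1
  change (r : ℝ) = _ at hr
  change (s : ℝ) = _ at hs
  have hab : a * r + b * s = 0 := by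
    rw [hr, hs]; rw [h] at hu hv; linarith
  have hne : (r : ℝ) ≠ 0 ∨ (s : ℝ) ≠ 0 := by
    by_contra! hcon
    refine huv (funext fun j => ?_)
    fin_cases j
    · change u 0 = v 0
      linarith [hcon.1]
    · change u 1 = v 1
      linarith [hcon.2]
  obtain ⟨μ, ha, hb⟩ : ∃ μ : ℝ, a = -μ * s ∧ b = μ * r := by
    by_cases hr0 : (r : ℝ) = 0
    · have hs0 := hne.resolve_left (not_not.2 hr0)
      refine ⟨-a / s, by field_simp, ?_⟩
      rw [hr0, mul_zero, zero_add] at hab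
      rw [hr0, mul_zero]
      exact (mul_eq_zero.1 hab).resolve_right hs0
    · refine ⟨b / r, ?_, by field_simp⟩
      field_simp; linarith
  have hμ : μ ≠ 0 := by
    rintro rfl
    apply hx₀
    rw [h] at hz
    rw [h, ha, hb]
    rw [ha, hb] at hz
    linarith
  set N : ℝ := (r.den : ℝ) * s.den with hN
  have hNpos : 0 < N := by
    have := r.den_pos
    have := s.den_pos
    positivity
  have hrN : (r : ℝ) * N = (r.num * s.den : ℤ) := by
    have : (r : ℝ) * r.den = r.num := by exact_mod_cast r.mul_den_eq_num
    rw [hN, ← mul_assoc, this]; push_cast; ring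
  have hsN : (s : ℝ) * N = (s.num * r.den : ℤ) := by
    have : (s : ℝ) * s.den = s.num := by exact_mod_cast s.mul_den_eq_num
    rw [hN, mul_comm (r.den : ℝ), ← mul_assoc, this]; push_cast; ring
  set n0 : ℤ := r.num * s.den
  set n1 : ℤ := s.num * r.den
  -- The gradient is normal to the rational direction `(r, s)`, and `N` clears denominators.
  -- Anchoring at the integer zero `z` makes the constant term integral too.
  have hform : ∀ x, g x = μ / N * (-n1 * (x 0 - z 0) + n0 * (x 1 - z 1)) := by
    intro x
    have hz' := hz
    rw [h] at hz'
    simp only [intPoint] at hz'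
    rw [h, ← hrN, ← hsN]
    have : μ / N * (-(s * N) * (x 0 - z 0) + r * N * (x 1 - z 1))
        = -μ * s * (x 0 - z 0) + μ * r * (x 1 - z 1) := by
      field_simp
    rw [this, ← ha, ← hb]
    linarith
  rcases lt_or_gt_of_ne hμ with hneg | hpos
  · refine ⟨-μ / N, div_pos (neg_pos.2 hneg) hNpos, ![n1, -n0], n1 * z 0 - n0 * z 1, fun x => ?_⟩
    rw [hform]
    simp only [latForm, Fin.sum_univ_two, Matrix.cons_val_zero, Matrix.cons_val_one]
    push_cast; ring
  · refine ⟨μ / N, div_pos hpos hNpos, ![-n1, n0], -n1 * z 0 + n0 * z 1, fun x => ?_⟩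
    rw [hform]
    simp only [latForm, Fin.sum_univ_two, Matrix.cons_val_zero, Matrix.cons_val_one]
    push_cast; ring

/-- A cyclic linear system with positive coefficients in a subfield has its solution there. -/
lemma mem_of_cyclic_system {F : Subfield ℝ} {a s t : Fin 3 → ℝ} (hs : ∀ i, 0 < s i)
    (ht : ∀ i, 0 < t i) (hsF : ∀ i, s i ∈ F) (htF : ∀ i, t i ∈ F)
    (h : ∀ i, a (i + 1) * s i + a (i + 2) * t i = 1) (i : Fin 3) : a i ∈ F := by
  have idx : i + 1 + 1 = i + 2 ∧ i + 1 + 2 = i ∧ i + 2 + 1 = i ∧ i + 2 + 2 = i + 1 := by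
    revert i; decide
  obtain ⟨e1, e2, e3, e4⟩ := idx
  have k0 := h i
  have k1 := h (i + 1)
  have k2 := h (i + 2)
  rw [e1, e2] at k1
  rw [e3, e4] at k2
  have hd : 0 < s (i + 2) * s i * s (i + 1) + t i * t (i + 1) * t (i + 2) := by
    have := hs i; have := hs (i + 1); have := hs (i + 2)
    have := ht i; have := ht (i + 1); have := ht (i + 2)
    positivity
  have e : a i = (s i * s (i + 1) - t (i + 2) * s (i + 1) + t (i + 2) * t i) /
      (s (i + 2) * s i * s (i + 1) + t i * t (i + 1) * t (i + 2)) := by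
    rw [eq_div_iff hd.ne']
    linear_combination s i * s (i + 1) * k2 - t (i + 2) * s (i + 1) * k0 + t (i + 2) * t i * k1
  rw [e]
  refine F.div_mem ?_ ?_
  · exact F.add_mem (F.sub_mem (F.mul_mem (hsF _) (hsF _)) (F.mul_mem (htF _) (hsF _)))
      (F.mul_mem (htF _) (htF _))
  · exact F.add_mem (F.mul_mem (F.mul_mem (hsF _) (hsF _)) (hsF _))
      (F.mul_mem (F.mul_mem (htF _) (htF _)) (htF _))

/-- The coefficients of a rational planar vector in a rational basis are rational. -/
lemma mem_of_planar_combination {F : Subfield ℝ} {u v x : Fin 2 → ℝ} {s t : ℝ}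
    (hu : ∀ j, u j ∈ F) (hv : ∀ j, v j ∈ F) (hx : ∀ j, x j ∈ F)
    (hdet : u 0 * v 1 - u 1 * v 0 ≠ 0) (h : x = s • u + t • v) : s ∈ F ∧ t ∈ F := by
  have x0 : x 0 = s * u 0 + t * v 0 := by rw [h]; simp
  have x1 : x 1 = s * u 1 + t * v 1 := by rw [h]; simp
  have hdF : u 0 * v 1 - u 1 * v 0 ∈ F :=
    F.sub_mem (F.mul_mem (hu _) (hv _)) (F.mul_mem (hu _) (hv _))
  constructor
  · have : s = (x 0 * v 1 - x 1 * v 0) / (u 0 * v 1 - u 1 * v 0) := by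
      rw [eq_div_iff hdet, x0, x1]; ring
    rw [this]
    exact F.div_mem (F.sub_mem (F.mul_mem (hx _) (hv _)) (F.mul_mem (hx _) (hv _))) hdF
  · have : t = (u 0 * x 1 - u 1 * x 0) / (u 0 * v 1 - u 1 * v 0) := by
      rw [eq_div_iff hdet, x0, x1]; ring
    rw [this]
    exact F.div_mem (F.sub_mem (F.mul_mem (hu _) (hx _)) (F.mul_mem (hu _) (hx _))) hdF

end SplitRank

/-! ### The induced set and the position of `f`. -/

namespace SplitRank

variable {k : ℕ} {R : Matrix (Fin 2) (Fin k) ℚ} {f : Fin 2 → ℚ} {α : Fin k → ℝ}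

lemma convex_relaxation (R : Matrix (Fin 2) (Fin k) ℚ) (f : Fin 2 → ℚ) :
    Convex ℝ (relaxation R f) := by
  rintro u ⟨hu, hu0⟩ v ⟨hv, hv0⟩ a b ha hb hab
  refine ⟨?_, fun i => ?_⟩
  · have e : ∑ i, (a • u + b • v).2 i • col R i
        = a • ∑ i, u.2 i • col R i + b • ∑ i, v.2 i • col R i := by
      rw [Finset.smul_sum, Finset.smul_sum, ← Finset.sum_add_distrib]
      refine Finset.sum_congr rfl fun i _ => ?_
      simp [add_smul, smul_smul]
    rw [e, Prod.fst_add, Prod.smul_fst, Prod.smul_fst, ← hu, ← hv]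
    have : toReal f = a • toReal f + b • toReal f := by rw [← add_smul, hab, one_smul]
    conv_lhs => rw [this]
    simp only [smul_add]
    abel
  · exact add_nonneg (mul_nonneg ha (hu0 i)) (mul_nonneg hb (hv0 i))

lemma mem_inducedSet_of_mem_convexHull {x : Fin 2 → ℝ}
    (hx : x ∈ convexHull ℝ (insert (toReal f)
      {y | ∃ i, 0 < α i ∧ y = toReal f + (α i)⁻¹ • col R i})) :
    x ∈ inducedSet R f α :=
  ⟨x, hx, 0, ⟨0, fun _ => le_rfl, fun _ _ => rfl, by simp⟩, add_zero x⟩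

/-- If the induced set is bounded, all coefficients are positive. -/
lemma coeff_pos_of_isBounded (hR : ∀ i, col R i ≠ 0) (hα : ∀ i, 0 ≤ α i)
    (hb : Bornology.IsBounded (inducedSet R f α)) (i : Fin k) : 0 < α i := by
  refine (hα i).lt_of_ne fun h0 => ?_
  obtain ⟨C, hC⟩ := hb.exists_norm_le
  have hr : 0 < ‖col R i‖ := norm_pos_iff.2 (hR i)
  have hC0 : 0 ≤ C := (norm_nonneg _).trans
    (hC _ (mem_inducedSet_of_mem_convexHull (subset_convexHull ℝ _ (Set.mem_insert _ _))))
  set t : ℝ := (C + ‖toReal f‖ + 1) / ‖col R i‖ with ht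
  have ht0 : 0 ≤ t := by positivity
  have hmem : toReal f + t • col R i ∈ inducedSet R f α := by
    refine ⟨toReal f, subset_convexHull ℝ _ (Set.mem_insert _ _), t • col R i,
      ⟨Pi.single i t, fun j => ?_, fun j hj => ?_, ?_⟩, rfl⟩
    · by_cases h : j = i
      · subst h; simpa using ht0
      · simp [h]
    · have : j ≠ i := by rintro rfl; exact hj h0.symm
      simp [this]
    · rw [Finset.sum_eq_single i]
      · simp
      · intro j _ hj; simp [hj]
      · simp
  have h1 := hC _ hmem
  have h2 : ‖t • col R i‖ = C + ‖toReal f‖ + 1 := by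
    rw [norm_smul, Real.norm_of_nonneg ht0, ht]; field_simp
  have h3 : ‖t • col R i‖ ≤ ‖toReal f + t • col R i‖ + ‖toReal f‖ := by
    have := norm_sub_le (toReal f + t • col R i) (toReal f)
    rwa [add_sub_cancel_left] at this
  linarith

lemma inducedSet_eq_convexHull (hα : ∀ i, 0 < α i) :
    inducedSet R f α =
      convexHull ℝ (insert (toReal f) {y | ∃ i, y = toReal f + (α i)⁻¹ • col R i}) := by
  have e : {y | ∃ i, 0 < α i ∧ y = toReal f + (α i)⁻¹ • col R i}
      = {y | ∃ i, y = toReal f + (α i)⁻¹ • col R i} := by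
    ext y; exact ⟨fun ⟨i, _, h⟩ => ⟨i, h⟩, fun ⟨i, h⟩ => ⟨i, hα i, h⟩⟩
  refine Set.Subset.antisymm ?_ fun x hx => mem_inducedSet_of_mem_convexHull (by rwa [e])
  rintro _ ⟨x, hx, _, ⟨c, _, hc, rfl⟩, rfl⟩
  rw [e] at hx
  have : ∑ i, c i • col R i = 0 :=
    Finset.sum_eq_zero fun i _ => by rw [hc i (hα i).ne', zero_smul]
  simpa [this] using hx

/-- A vertex of a triangle generated as a convex hull of a set belongs to that set. -/
lemma vertex_mem_of_convexHull_eq (b : AffineBasis (Fin 3) ℝ (Fin 2 → ℝ)) {P : Set (Fin 2 → ℝ)}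
    (h : convexHull ℝ P = convexHull ℝ (Set.range b)) (i : Fin 3) : b i ∈ P := by
  by_contra hi
  -- The vertex is the only point of the triangle with i-th coordinate 1, so without it `P` lies in
  -- an open half-plane that misses it.
  have hlt : P ⊆ {x | b.coord i x < 1} := by
    intro x hx
    have hx' : x ∈ convexHull ℝ (Set.range b) := h ▸ subset_convexHull ℝ P hx
    rw [b.convexHull_eq_nonneg_coord] at hx'
    have hsum := b.sum_coord_apply_eq_one x
    have hle : b.coord i x ≤ 1 := by
      rw [← hsum]; exact Finset.single_le_sum (fun j _ => hx' j) (Finset.mem_univ i)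
    refine hle.lt_of_ne fun h1 => hi ?_
    have hz : ∀ j ≠ i, b.coord j x = 0 := by
      intro j hj
      have := Finset.add_le_sum (f := fun j => b.coord j x) (fun j _ => hx' j)
        (Finset.mem_univ i) (Finset.mem_univ j) hj.symm
      exact le_antisymm (by linarith) (hx' j)
    have : x = b i := b.ext_elem fun j => by
      by_cases hj : j = i
      · subst hj; rw [h1, b.coord_apply_eq]
      · rw [hz j hj, b.coord_apply_ne hj]
    exact this ▸ hx
  have hconv : Convex ℝ {x | b.coord i x < 1} :=
    (convex_Iio (1 : ℝ)).affine_preimage (b.coord i)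
  have : b i ∈ convexHull ℝ P := h ▸ subset_convexHull ℝ _ (Set.mem_range_self i)
  have := convexHull_min hlt hconv this
  simp at this

/-- A ray hitting an integer point strictly before the value `1` contradicts validity. -/
lemma not_isValidIneq_of_ray {m : Fin k} (hαm : 0 < α m) {y : Fin 2 → ℝ}
    (hy : y ∈ latticePoints 2) {θ : ℝ} (h0 : 0 ≤ θ) (h1 : θ < 1)
    (he : y = toReal f + θ • ((α m)⁻¹ • col R m)) :
    ¬ IsValidIneq 0 (-α) (-1) (convexHull ℝ (mixedIntegerSet R f)) := by
  intro hv
  have hmem : (y, Pi.single m (θ * (α m)⁻¹)) ∈ mixedIntegerSet R f := by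
    refine ⟨⟨?_, fun i => ?_⟩, hy⟩
    · rw [he, Finset.sum_eq_single m]
      · simp [smul_smul]
      · intro j _ hj; simp [hj]
      · simp
    · by_cases h : i = m
      · subst h; simp only [Pi.single_eq_same]; positivity
      · simp [h]
  have h := hv _ (subset_convexHull ℝ _ hmem)
  rw [Finset.sum_eq_single m (f := fun i => (-α) i * _)] at h
  · simp at h
    rw [mul_comm θ, mul_inv_cancel_left₀ hαm.ne'] at h
    linarith
  · intro j _ hj; simp [hj]
  · simp

section Interior

variable {b : AffineBasis (Fin 3) ℝ (Fin 2 → ℝ)} {y : Fin 3 → Fin 2 → ℤ}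

/-- Validity of the inequality forces `f` into the interior of the triangle. -/
lemma coord_pos_of_isValidIneq (hα : ∀ i, 0 < α i)
    (hvert : ∀ i, b i = toReal f ∨ ∃ m, b i = toReal f + (α m)⁻¹ • col R m)
    (hf : toReal f ∉ latticePoints 2) (hf0 : ∀ i, 0 ≤ b.coord i (toReal f))
    (hy0 : ∀ i, b.coord i (intPoint (y i)) = 0)
    (hy1 : ∀ i, 0 < b.coord i (intPoint (y (i + 1))))
    (hy2 : ∀ i, 0 < b.coord i (intPoint (y (i + 2))))
    (hv : IsValidIneq 0 (-α) (-1) (convexHull ℝ (mixedIntegerSet R f))) (i : Fin 3) :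
    0 < b.coord i (toReal f) := by
  refine (hf0 i).lt_of_ne fun hfi => ?_
  have idx : i + 1 ≠ i ∧ i + 2 ≠ i ∧ i + 1 ≠ i + 2 ∧ i + 1 + 2 = i ∧ i + 2 + 1 = i := by
    clear * -; revert i; decide
  obtain ⟨n1, n2, n12, e1, e2⟩ := idx
  have hsum : ∀ x, b.coord i x + b.coord (i + 1) x + b.coord (i + 2) x = 1 := by
    intro x
    have := b.sum_coord_apply_eq_one x
    rw [Fin.sum_univ_three] at this
    clear * - this
    fin_cases i
    · exact this
    · change b.coord 1 x + b.coord 2 x + b.coord 0 x = 1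
      linarith
    · change b.coord 2 x + b.coord 0 x + b.coord 1 x = 1
      linarith
  -- With `f` on side `i`, this would put `y i` strictly before the vertex `b j` on the ray from
  -- `f`. Excluding both directions leaves only `f = y i`.
  have key : ∀ j, j ≠ i → 0 < b.coord j (intPoint (y i)) → b.coord j (intPoint (y i)) < 1 →
      ¬ b.coord j (toReal f) < b.coord j (intPoint (y i)) := by
    intro j hj hpos hlt1 hlt
    have hne : b j ≠ toReal f := by
      intro h
      rw [← h, b.coord_apply_eq] at hlt
      linarith
    obtain ⟨m, hm⟩ := (hvert j).resolve_left hne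
    set c := b.coord j (toReal f)
    set d := b.coord j (intPoint (y i))
    have hc : 0 < 1 - c := by linarith
    refine not_isValidIneq_of_ray (hα m) ⟨y i, rfl⟩ (θ := (d - c) / (1 - c))
      (div_nonneg (by linarith) hc.le) ((div_lt_one hc).2 (by linarith)) ?_ hv
    have hd : (α m)⁻¹ • col R m = b j - toReal f := by rw [hm]; abel
    rw [hd]
    set θ := (d - c) / (1 - c) with hθ
    have hline : toReal f + θ • (b j - toReal f) = AffineMap.lineMap (toReal f) (b j) θ := by
      rw [AffineMap.lineMap_apply]; simp [add_comm]
    rw [hline]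
    have hcj : b.coord j (AffineMap.lineMap (toReal f) (b j) θ) = d := by
      rw [AffineMap.apply_lineMap, AffineMap.lineMap_apply_ring', b.coord_apply_eq]
      change θ * (1 - c) + c = d
      rw [hθ]; field_simp; ring
    have hci : b.coord i (AffineMap.lineMap (toReal f) (b j) θ) = 0 := by
      rw [AffineMap.apply_lineMap, AffineMap.lineMap_apply_ring', b.coord_apply_ne hj.symm, ← hfi]
      ring
    have s1 := hsum (AffineMap.lineMap (toReal f) (b j) θ)
    have s2 := hsum (intPoint (y i))
    refine b.ext_elem fun l => ?_
    have hl : l = i ∨ l = i + 1 ∨ l = i + 2 := by clear * -; revert l i; decide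
    have hj' : j = i + 1 ∨ j = i + 2 := by clear * - hj; revert j i; decide
    have hdd : b.coord j (intPoint (y i)) = d := rfl
    change b.coord l (intPoint (y i)) = _
    rw [hci] at s1
    rw [hy0] at s2
    rcases hl with rfl | rfl | rfl
    · rw [hci]; exact hy0 _
    · rcases hj' with rfl | rfl
      · exact hcj.symm
      · linarith
    · rcases hj' with rfl | rfl
      · linarith
      · exact hcj.symm
  have p1 := hy2 (i + 1)
  have p2 := hy1 (i + 2)
  rw [e1] at p1
  rw [e2] at p2
  have s := hsum (intPoint (y i))
  have sf := hsum (toReal f)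
  rw [hy0] at s
  rw [← hfi] at sf
  have k1 := key _ n1 p1 (by linarith)
  have k2 := key _ n2 p2 (by linarith)
  refine hf ⟨y i, b.ext_elem fun l => ?_⟩
  change b.coord l (intPoint (y i)) = _
  have hl : l = i ∨ l = i + 1 ∨ l = i + 2 := by clear * -; revert l i; decide
  rcases hl with rfl | rfl | rfl
  · rw [hy0]; exact hfi
  · linarith
  · linarith

end Interior
end SplitRank

/-! ### Rational vertices and the slack bound on the relaxation. -/

namespace SplitRank

section Interior

variable {k : ℕ} {R : Matrix (Fin 2) (Fin k) ℚ} {f : Fin 2 → ℚ} {α : Fin k → ℝ}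
variable {b : AffineBasis (Fin 3) ℝ (Fin 2 → ℝ)} {y : Fin 3 → Fin 2 → ℤ} {m : Fin 3 → Fin k}

lemma affineMap_ray (g : (Fin 2 → ℝ) →ᵃ[ℝ] ℝ) (x r : Fin 2 → ℝ) (c : ℝ) :
    g (x + c • r) = g x + c * g.linear r := by
  have h := g.map_vadd x (c • r)
  rw [vadd_eq_add, vadd_eq_add, add_comm] at h
  rw [h, map_smul, smul_eq_mul, add_comm]

/-- The vertices of the triangle are rational. -/
lemma vertex_rational (hα : ∀ i, 0 < α i)
    (hm : ∀ i, b i = toReal f + (α (m i))⁻¹ • col R (m i))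
    (hf : ∀ i, 0 < b.coord i (toReal f))
    (hy : ∀ i, ∃ μ ν : ℝ, 0 < μ ∧ 0 < ν ∧ μ + ν = 1 ∧
      intPoint (y i) = μ • b (i + 1) + ν • b (i + 2)) (i : Fin 3) (j : Fin 2) :
    b i j ∈ ratField := by
  choose μ ν hμ hν hμν hyeq using hy
  have hlin : ∀ i j, j ≠ i →
      (b.coord i).linear (col R (m j)) = -(α (m j) * b.coord i (toReal f)) := by
    intro i j hji
    have h := b.coord_apply_ne hji.symm
    have hαj := hα (m j)
    rw [hm j, affineMap_ray] at h
    field_simp at h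
    linarith
  -- If two vertex rays were parallel, `hlin` would fix their ratio so that the two vertices
  -- coincide.
  have hdet : ∀ i : Fin 3, col R (m (i + 1)) 0 * col R (m (i + 2)) 1
      - col R (m (i + 1)) 1 * col R (m (i + 2)) 0 ≠ 0 := by
    intro i hd
    have idx : i + 1 ≠ i ∧ i + 2 ≠ i ∧ i + 1 ≠ i + 2 := by clear * -; revert i; decide
    obtain ⟨n1, n2, n12⟩ := idx
    have l1 := hlin i _ n1
    have l2 := hlin i _ n2
    set u := col R (m (i + 1))
    set v := col R (m (i + 2))
    have hexp : ∀ x : Fin 2 → ℝ, (b.coord i).linear x =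
        x 0 * (b.coord i).linear (Pi.single 0 1) + x 1 * (b.coord i).linear (Pi.single 1 1) := by
      intro x
      have hx : x = x 0 • Pi.single 0 1 + x 1 • Pi.single 1 1 := by
        ext j; fin_cases j <;> simp
      conv_lhs => rw [hx]
      simp only [map_add, map_smul, smul_eq_mul]
    have hpar : (b.coord i).linear v • u = (b.coord i).linear u • v := by
      rw [hexp u, hexp v]
      ext l
      fin_cases l
      · simp only [Pi.smul_apply, smul_eq_mul, Fin.zero_eta]
        linear_combination (b.coord i).linear (Pi.single 1 1) * hd
      · simp only [Pi.smul_apply, smul_eq_mul, Fin.mk_one]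
        linear_combination (-(b.coord i).linear (Pi.single 0 1)) * hd
    rw [l1, l2] at hpar
    refine n12 (b.ind.injective ?_)
    rw [hm, hm]
    congr 1
    have a1 := (hα (m (i + 1))).ne'
    have a2 := (hα (m (i + 2))).ne'
    have hfi := (hf i).ne'
    change (α (m (i + 1)))⁻¹ • u = (α (m (i + 2)))⁻¹ • v
    ext l
    have h := congrFun hpar l
    simp only [Pi.smul_apply, smul_eq_mul] at h ⊢
    field_simp
    have h' : b.coord i (toReal f) * (u l * α (m (i + 2)))
        = b.coord i (toReal f) * (v l * α (m (i + 1))) := by linarith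
    exact (mul_left_cancel₀ hfi h').trans (mul_comm _ _)
  have hdecomp : ∀ i, intPoint (y i) - toReal f = (μ i / α (m (i + 1))) • col R (m (i + 1))
      + (ν i / α (m (i + 2))) • col R (m (i + 2)) := by
    intro i
    rw [hyeq, hm, hm]
    ext l
    simp only [Pi.sub_apply, Pi.add_apply, Pi.smul_apply, smul_eq_mul]
    linear_combination (toReal f l) * hμν i
  have hst := fun i => mem_of_planar_combination (F := ratField)
    (fun j => ratCast_mem (R j (m (i + 1)))) (fun j => ratCast_mem (R j (m (i + 2))))
    (fun j => ratField.sub_mem (intCast_mem_ratField (y i j)) (ratCast_mem (f j)))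
    (hdet i) (hdecomp i)
  -- The weights of `y i - f` on the two rays are rational, and μᵢ + νᵢ = 1 turns them into a cyclic
  -- system for the coefficients.
  have hαrat : ∀ i, α (m i) ∈ ratField := by
    refine mem_of_cyclic_system (a := fun i => α (m i))
      (fun i => div_pos (hμ i) (hα _)) (fun i => div_pos (hν i) (hα _))
      (fun i => (hst i).1) (fun i => (hst i).2) fun i => ?_
    have a1 := (hα (m (i + 1))).ne'
    have a2 := (hα (m (i + 2))).ne'
    rw [mul_div_cancel₀ _ a1, mul_div_cancel₀ _ a2, hμν]
  rw [hm]
  exact ratField.add_mem (ratCast_mem _)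
    (ratField.mul_mem (ratField.inv_mem (hαrat i)) (ratCast_mem _))

/-- The coordinate is still nonnegative at f + rʲ/αⱼ, so it falls along rʲ at a rate of at most αⱼ
times its value at `f`; the rays then add up. -/
lemma slack_le_of_mem_relaxation (hα : ∀ i, 0 < α i)
    (hray : ∀ i j, 0 ≤ b.coord i (toReal f + (α j)⁻¹ • col R j))
    (hf : ∀ i, 0 < b.coord i (toReal f)) {z : (Fin 2 → ℝ) × (Fin k → ℝ)}
    (hz : z ∈ relaxation R f) (i : Fin 3) :
    1 - b.coord i z.1 / b.coord i (toReal f) ≤ ∑ j, α j * z.2 j := by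
  have h := (b.coord i).map_vadd (toReal f) (∑ j, z.2 j • col R j)
  rw [vadd_eq_add, vadd_eq_add, add_comm, hz.1, map_sum] at h
  have hle : ∀ j, -(b.coord i (toReal f) * (α j * z.2 j)) ≤
      (b.coord i).linear (z.2 j • col R j) := by
    intro j
    have h1 := hray i j
    rw [affineMap_ray] at h1
    have h2 : -(α j * b.coord i (toReal f)) ≤ (b.coord i).linear (col R j) := by
      have := mul_nonneg (hα j).le h1
      rw [mul_add, mul_inv_cancel_left₀ (hα j).ne'] at this
      linarith
    rw [map_smul, smul_eq_mul]
    nlinarith [hz.2 j]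
  have hs := Finset.sum_le_sum fun j (_ : j ∈ Finset.univ) => hle j
  rw [Finset.sum_neg_distrib, ← Finset.mul_sum] at hs
  have hpos := hf i
  rw [sub_le_iff_le_add', ← sub_le_iff_le_add, le_div_iff₀ hpos]
  linarith

end Interior

lemma splitRank_lt_top {p q : ℕ} {S : Set ((Fin p → ℝ) × (Fin q → ℝ))} {a : Fin p → ℝ}
    {b : Fin q → ℝ} {c : ℝ} {n : ℕ} (h : IsValidIneq a b c (iterSplitClosure S n)) :
    splitRank S a b c < ⊤ :=
  lt_of_le_of_lt (sInf_le ⟨n, rfl, h⟩) (ENat.natCast_lt_top n)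

end SplitRank

/-! ### Assembly of the theorem. -/

theorem mainTheorem4 (k : ℕ) (R : Matrix (Fin 2) (Fin k) ℚ) (f : Fin 2 → ℚ)
    (hf : SplitRank.toReal f ∉ SplitRank.latticePoints 2)
    (hR : ∀ i, SplitRank.col R i ≠ 0)
    (hP : (SplitRank.mixedIntegerSet R f).Nonempty)
    (α : Fin k → ℝ) (hα : ∀ i, 0 ≤ α i)
    (hvalid : SplitRank.IsValidIneq 0 (-α) (-1)
      (convexHull ℝ (SplitRank.mixedIntegerSet R f)))
    (hT3 : SplitRank.IsTypeT3 (SplitRank.inducedSet R f α)) :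
    SplitRank.splitRank (SplitRank.relaxation R f) 0 (-α) (-1) < ⊤ := by
  open SplitRank in
  obtain ⟨w, hw, hT, hfree, hnon, hcard, hside⟩ := hT3
  have hspan : affineSpan ℝ (Set.range w) = ⊤ := by
    rw [hw.affineSpan_eq_top_iff_card_eq_finrank_add_one]; simp
  set b : AffineBasis (Fin 3) ℝ (Fin 2 → ℝ) := ⟨w, hw, hspan⟩
  have hT' : inducedSet R f α = convexHull ℝ (Set.range b) := hT
  have hTcoord : inducedSet R f α = {x | ∀ i, 0 ≤ b.coord i x} := by
    rw [hT', b.convexHull_eq_nonneg_coord]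
  have hcpt : IsCompact (inducedSet R f α) := by
    rw [hT]; exact (Set.finite_range w).isCompact_convexHull ℝ
  have hint : interior (inducedSet R f α) = {x | ∀ i, 0 < b.coord i x} := by
    rw [hT', b.interior_convexHull]
  have hαp := coeff_pos_of_isBounded hR hα hcpt.isBounded
  have hhull := inducedSet_eq_convexHull (R := R) (f := f) hαp
  -- the three integer points
  have hex : ∀ i : Fin 3, ∃ z : Fin 2 → ℤ, ∃ μ ν : ℝ, 0 < μ ∧ 0 < ν ∧ μ + ν = 1 ∧
      intPoint z = μ • b (i + 1) + ν • b (i + 2) := by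
    intro i
    obtain ⟨_, ⟨⟨μ, ν, hμ, hν, hμν, h⟩, z, rfl⟩, -⟩ :=
      hside (i + 1) (i + 2) (by revert i; decide)
    exact ⟨z, μ, ν, hμ, hν, hμν, h.symm⟩
  choose y hy using hex
  have hval : ∀ i, b.coord i (intPoint (y i)) = 0 ∧ 0 < b.coord (i + 1) (intPoint (y i)) ∧
      0 < b.coord (i + 2) (intPoint (y i)) := by
    intro i
    obtain ⟨μ, ν, hμ, hν, hμν, h⟩ := hy i
    have hc : ∀ l, b.coord l (intPoint (y i))
        = μ * b.coord l (b (i + 1)) + ν * b.coord l (b (i + 2)) := by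
      intro l
      rw [h]
      exact Convex.combo_affine_apply (f := b.coord l) hμν
    have idx : i ≠ i + 1 ∧ i ≠ i + 2 ∧ i + 1 ≠ i + 2 := by clear * -; revert i; decide
    obtain ⟨n1, n2, n12⟩ := idx
    refine ⟨?_, ?_, ?_⟩
    · rw [hc, b.coord_apply_ne n1, b.coord_apply_ne n2]; ring
    · rw [hc, b.coord_apply_eq, b.coord_apply_ne n12]; linarith
    · rw [hc, b.coord_apply_eq, b.coord_apply_ne n12.symm]; linarith
  have idx : ∀ i : Fin 3, i + 1 + 2 = i ∧ i + 2 + 1 = i := by decide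
  have hy0 := fun i => (hval i).1
  have hy1 : ∀ i, 0 < b.coord i (intPoint (y (i + 1))) := by
    intro i
    have := (hval (i + 1)).2.2
    rwa [(idx i).1] at this
  have hy2 : ∀ i, 0 < b.coord i (intPoint (y (i + 2))) := by
    intro i
    have := (hval (i + 2)).2.1
    rwa [(idx i).2] at this
  have hinj : Function.Injective y := injective_of_slack (g := b.coord) hy0 hy1 hy2
  have hlat : ∀ z : Fin 2 → ℤ, (∀ i, 0 ≤ b.coord i (intPoint z)) → ∃ i, z = y i := by
    intro z hz
    have hsub : Set.range (fun i => intPoint (y i)) ⊆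
        frontier (inducedSet R f α) ∩ latticePoints 2 := by
      rintro _ ⟨i, rfl⟩
      refine ⟨⟨subset_closure ?_, ?_⟩, y i, rfl⟩
      · rw [hTcoord]
        intro j
        have hj : j = i ∨ j = i + 1 ∨ j = i + 2 := by clear * -; revert j i; decide
        rcases hj with rfl | rfl | rfl
        · exact (hy0 _).ge
        · exact (hval i).2.1.le
        · exact (hval i).2.2.le
      · rw [hint]
        intro h
        exact (h i).ne' (hy0 i)
    have hinj' : Function.Injective fun i => intPoint (y i) := by
      intro i j hij
      refine hinj (funext fun l => ?_)
      exact Int.cast_injective (α := ℝ) (congrFun hij l)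
    have hncard : (Set.range fun i => intPoint (y i)).ncard = 3 := by
      rw [← Set.image_univ, Set.ncard_image_of_injective _ hinj']
      simp
    -- The count of three leaves no boundary integer point other than the `y i`.
    have heq := Set.eq_of_subset_of_ncard_le hsub (by rw [hcard, hncard])
      (Set.finite_of_ncard_ne_zero (by rw [hcard]; norm_num))
    have hzT : intPoint z ∈ inducedSet R f α := by rw [hTcoord]; exact hz
    have hzmem : intPoint z ∈ frontier (inducedSet R f α) ∩ latticePoints 2 := by
      refine ⟨⟨subset_closure hzT, fun hzi => ?_⟩, z, rfl⟩
      have : intPoint z ∈ interior (inducedSet R f α) ∩ latticePoints 2 := ⟨hzi, z, rfl⟩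
      rw [hfree] at this
      exact this
    rw [← heq] at hzmem
    obtain ⟨i, hi⟩ := hzmem
    refine ⟨i, funext fun l => ?_⟩
    exact Int.cast_injective (α := ℝ) (congrFun hi l).symm
  -- the position of `f` and of the rays
  have hvert : ∀ i, b i = toReal f ∨ ∃ m, b i = toReal f + (α m)⁻¹ • col R m := fun i =>
    vertex_mem_of_convexHull_eq b (hhull.symm.trans hT') i
  have hray : ∀ i j, 0 ≤ b.coord i (toReal f + (α j)⁻¹ • col R j) := by
    intro i j
    have : toReal f + (α j)⁻¹ • col R j ∈ inducedSet R f α := by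
      rw [hhull]; exact subset_convexHull ℝ _ (Set.mem_insert_of_mem _ ⟨j, rfl⟩)
    rw [hTcoord] at this
    exact this i
  have hf0 : ∀ i, 0 ≤ b.coord i (toReal f) := by
    have : toReal f ∈ inducedSet R f α := by
      rw [hhull]; exact subset_convexHull ℝ _ (Set.mem_insert _ _)
    rw [hTcoord] at this
    exact this
  have hfpos := coord_pos_of_isValidIneq hαp hvert hf hf0 hy0 hy1 hy2 hvalid
  have hvert' : ∀ i, ∃ m, b i = toReal f + (α m)⁻¹ • col R m := by
    intro i
    refine (hvert i).resolve_left fun h => ?_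
    have h1 := hfpos (i + 1)
    rw [← h, b.coord_apply_ne (by clear * -; revert i; decide)] at h1
    exact lt_irrefl _ h1
  choose m hm using hvert'
  have hratl := vertex_rational hαp hm hfpos hy
  -- Scaling each slack to the value 1 at `f` gives ζ ≥ 1 - gᵢ on the relaxation.
  set g : Fin 3 → (Fin 2 → ℝ) →ᵃ[ℝ] ℝ := fun i => (b.coord i (toReal f))⁻¹ • b.coord i with hg
  have hgx : ∀ i x, g i x = b.coord i x / b.coord i (toReal f) := by
    intro i x
    rw [hg]; simp [div_eq_inv_mul]
  have hgnn : ∀ i x, 0 ≤ g i x ↔ 0 ≤ b.coord i x := by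
    intro i x
    rw [hgx, le_div_iff₀ (hfpos i), zero_mul]
  have hratg : ∀ i, ∃ κ > 0, ∃ (ρ : Fin 2 → ℤ) (ρ₀ : ℤ), ∀ x, g i x = κ * latForm ρ ρ₀ x := by
    intro i
    have idx : i ≠ i + 1 ∧ i ≠ i + 2 ∧ i + 1 ≠ i + 2 := by clear * -; revert i; decide
    obtain ⟨n1, n2, n12⟩ := idx
    refine exists_latForm_of_rational (g i) (u := b (i + 1)) (v := b (i + 2)) (z := y i)
      (x₀ := toReal f) ?_ ?_ ?_ (fun h => n12 (b.ind.injective h))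
      (fun j => ratField.sub_mem (hratl _ j) (hratl _ j)) ?_
    · rw [hgx, b.coord_apply_ne n1, zero_div]
    · rw [hgx, b.coord_apply_ne n2, zero_div]
    · rw [hgx, hy0, zero_div]
    · rw [hgx, div_self (hfpos i).ne']; exact one_ne_zero
  set ζ : (Fin k → ℝ) →ₗ[ℝ] ℝ := ∑ j, α j • LinearMap.proj j with hζ
  have hζx : ∀ s, ζ s = ∑ j, α j * s j := by
    intro s
    rw [hζ]; simp
  obtain ⟨n, hn⟩ := exists_one_le_of_triangle (y := y) (g := g) (ζ := ζ)
    (S := relaxation R f)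
    (fun i => by rw [hgx, hy0, zero_div])
    (fun i => by rw [hgx]; exact div_pos (hy1 i) (hfpos i))
    (fun i => by rw [hgx]; exact div_pos (hy2 i) (hfpos i))
    (fun z hz => hlat z fun i => (hgnn i _).1 (hz i)) hratg
    (by simp only [hgnn]; rw [← hTcoord]; exact hcpt)
    (convex_relaxation R f)
    (fun z hz i => by
      rw [hgx, hζx]; exact slack_le_of_mem_relaxation hαp hray hfpos hz i)
    (fun z hz => by
      rw [hζx]; exact Finset.sum_nonneg fun j _ => mul_nonneg (hα j) (hz.2 j))
  refine splitRank_lt_top (n := n) fun z hz => ?_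
  have h := hn z hz
  rw [hζx] at h
  simpa [Finset.sum_neg_distrib] using h
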